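/- **Definitions.** Tournaments are finite. Fix $k\in\mathbb N$ and write $[k]=\{1,\dots,k\}$. *Bags.* A *bag* $B$ of order $k$ consists of an internal tournament on a finite vertex set $V(B)$, a boundary bipartite tournament between $[k]$ and $V(B)$ (exactly one of $i\to v$, $v\to i$ for each $i\in[k]$, $v\in V(B)$), a colouring $\lambda_B:V(B)\to[k]$ and a recolouring function $\rho_B:[k]\to[k]$. Bags are considered up to isomorphism. The product $A\cdot B$ has internal vertices $V(A)\uplus V(B)$; internal edges inside $V(A)$ and $V(B)$ are kept, and for $x\in V(A)$, $y\in V(B)$ one has $x\to y$ if and only if $\lambda_A(x)\to y$ in the boundary of $B$. The boundary edge between $i\in[k]$ and $x\in V(A)$ is as in $A$, and for $y\in V(B)$ one has $i\to y$ in $A\cdot B$ if and only if $\rho_A(i)\to y$ in $B$. Finally $\lambda_{A\cdot B}$ is $\rho_B\circ\lambda_A$ on $V(A)$ and $\lambda_B$ on $V(B)$, and $\rho_{A\cdot B}=\rho_B\circ\rho_A$. A bag is *atomic* if it has at most one internal vertex; $\mathfrak C_k$ is the monoid generated by the atomic bags of order $k$, with neutral element the empty bag with identity recolouring. *Types.*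 The type of $v\in V(B)$ is the pair $(\lambda_B(v),\{i\in[k]: i\to v\})$. The type of $B$ records $\rho_B$, the set of vertex types that occur in $B$, and, for each pair $\alpha,\beta$ of occurring types, whether all edges between the vertices of type $\alpha$ and those of type $\beta$ go from the former to the latter, all go from the latter to the former, or neither. The type of $A\cdot B$ only depends on the types of $A$ and $B$, so types form a monoid. *Factorisation depth.* "Having factorisation depth at most $(p,q)$" is the least relation such that: atomic bags have depth at most $(p,q)$ for all $p,q\ge 0$; if $A,B$ have depth at most $(p,q)$ then $A\cdot B$ has depth at most $(p,q+1)$; if $n\ge 1$ and $B_1,\dots,B_n$ all have the same idempotent type and depth at most $(p,q)$, then $B_1\cdots B_n$ has depth at most $(p+1,q)$. For $p\ge1$, an *idempotent factorisation of depth at most $(p,q)$* of a bag $B$ is an expression $B=B_1\cdots B_n$ with $n\ge1$, where all $B_i\in\mathfrak C_k$ have the same idempotent type and factorisation depth at most $(p-1,q)$. *Transductions.* An FO transduction is a non-deterministic map from structures to structures given by a finite sequence of first-order interpretations, colourings by new unary predicates, filterings by a sentence, universe restrictions by a formula, and copyings. It is an *extension* transduction if each of its outputs is the input structure with additional relations.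 For a finite directed graph $(V,E)$ and disjoint $X,Y\subseteq V$, $\mathrm{rk}(X;Y)$ is the rank over $\mathbb F_2$ of the adjacency matrix with rows $X$ and columns $Y$. **Statement.** Given $k\in\mathbb N$, one can compute an extension FO transduction $\Psi_k$ from signature $\{E\}$ to signature $\{E,\preceq\}$ (that is, some function $k\mapsto\Psi_k$ with the following property is computable), such that for all $q\ge 0$ and $p\ge 1$: if $T=(V,E)$ is the internal tournament of a bag $B\in\mathfrak C_k$ that has an idempotent factorisation of depth at most $(p,q)$, then there is a quasi-ordering $\preceq$ of $V$ with equivalence classes $X_1\preceq\dots\preceq X_m$ such that 1. for each $i\in[m]$, $T[X_i]$ is the internal tournament of a bag in $\mathfrak C_k$ of factorisation depth at most $(p-1,q+2p)$; 2. for each $i\in[m]$, $\mathrm{rk}(X_1\cup\dots\cup X_i;\ X_{i+1}\cup\dots\cup X_m)\le k\cdot(2^k+1)$; 3. $(V,E,\preceq)\in\Psi_k(T)$. -/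

import Mathlib

namespace TournTrans

open FirstOrder

/-! ### Relational structures and first-order formulas -/

/-- A finite relational signature: the (finitely supported) function giving, for each arity, the
number of relation symbols of that arity.  The symbols of arity `n` are the elements of
`Fin (Γ n)`.  Adding signatures is taking their disjoint union. -/
abbrev Sig : Type := ℕ →₀ ℕ

/-- The first-order language without function symbols and with the relation symbols of `Γ`. -/
abbrev Sig.lang (Γ : Sig) : FirstOrder.Language.{0, 0} := ⟨fun _ => Empty, fun n => Fin (Γ n)⟩

/-- A relational structure over the signature `Γ`. -/
structure RelStr (Γ : Sig) where
  /-- The universe of the structure. -/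
  V : Type
  /-- The interpretation of each relation symbol. -/
  rel : ∀ n : ℕ, Fin (Γ n) → (Fin n → V) → Prop

/-- Formulas over `Γ` are evaluated in a `Γ`-structure with Mathlib's semantics. -/
instance RelStr.instStructure {Γ : Sig} (S : RelStr Γ) : Γ.lang.Structure S.V where
  funMap := fun f _ => Empty.elim f
  RelMap := fun {n} R t => S.rel n R t

/-- `T` is an extension of `S` (and `S` a reduct of `T`): the structure `T` is `S` with additional
relations for the symbols of `Δ` which are not in `Γ`. -/
def RelStr.IsReductOf {Γ Δ : Sig} (h : Γ ≤ Δ) (S : RelStr Γ) (T : RelStr Δ) : Prop :=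
  ∃ r : ∀ n : ℕ, Fin (Δ n) → (Fin n → S.V) → Prop,
    T = ⟨S.V, r⟩ ∧
      ∀ (n : ℕ) (R : Fin (Γ n)) (t : Fin n → S.V), r n (Fin.castLE (h n) R) t ↔ S.rel n R t

/-! ### First-order transductions -/

/-- First-order transductions from `Γ`-structures to `Δ`-structures: finite sequences
of the five elementary operations. -/
inductive Transduction : Sig → Sig → Type
  /-- Interpretation: one formula over `Γ` with `n` free variables for each `n`-ary symbol of `Δ`. -/
  | interp {Γ Δ : Sig} (φ : ∀ n : ℕ, Fin (Δ n) → Γ.lang.Formula (Fin n)) : Transduction Γ Δ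
  /-- Colouring by `c` new unary predicates. -/
  | colour {Γ : Sig} (c : ℕ) : Transduction Γ (Γ + Finsupp.single 1 c)
  /-- Filtering by a sentence. -/
  | filter {Γ : Sig} (φ : Γ.lang.Sentence) : Transduction Γ Γ
  /-- Universe restriction by a formula with one free variable. -/
  | restrict {Γ : Sig} (φ : Γ.lang.Formula (Fin 1)) : Transduction Γ Γ
  /-- `m`-copying, with a new `m`-ary relation symbol relating the copies of each vertex. -/
  | copy {Γ : Sig} (m : ℕ) : Transduction Γ (Γ + Finsupp.single m 1)
  /-- Performing the first transduction, and then the second. -/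
  | comp {Γ Δ Θ : Sig} (Φ : Transduction Γ Δ) (Ψ : Transduction Δ Θ) : Transduction Γ Θ

/-- The set of possible outputs of the (non-deterministic) transduction `Φ` on the structure `S`. -/
def Transduction.outputs : ∀ {Γ Δ : Sig}, Transduction Γ Δ → RelStr Γ → Set (RelStr Δ)
  | _, _, .interp φ, S => {⟨S.V, fun n R t => (φ n R).Realize t⟩}
  | _, _, .colour _, S => {T | S.IsReductOf le_self_add T}
  | _, _, .filter φ, S => {T | T = S ∧ S.V ⊨ φ}
  | _, _, .restrict φ, S =>
      {⟨{v : S.V // φ.Realize (fun _ => v)}, fun n R t => S.rel n R (fun i => (t i).1)⟩}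
  | Γ, _, .copy m, S =>
      {T | ∃ r : ∀ n : ℕ, Fin ((Γ + Finsupp.single m 1 : Sig) n) → (Fin n → S.V × Fin m) → Prop,
        T = ⟨S.V × Fin m, r⟩ ∧
        (∀ (n : ℕ) (R : Fin (Γ n)) (t : Fin n → S.V × Fin m),
          r n (Fin.castLE (le_self_add (a := Γ) (b := Finsupp.single m 1) n) R) t ↔
            ∃ j : Fin m, (∀ i, (t i).2 = j) ∧ S.rel n R (fun i => (t i).1)) ∧
        ∀ t : Fin m → S.V × Fin m,
          r m ⟨Γ m, by simp⟩ t ↔ ∃ v : S.V, ∀ i, t i = (v, i)}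
  | _, _, .comp Φ Ψ, S => ⋃ T ∈ Φ.outputs S, Ψ.outputs T

/-- Extension transductions: every output is an extension of the input. -/
def Transduction.IsExtension {Γ Δ : Sig} (h : Γ ≤ Δ) (Φ : Transduction Γ Δ) : Prop :=
  ∀ (S : RelStr Γ) (T : RelStr Δ), T ∈ Φ.outputs S → S.IsReductOf h T

/-! ### Gödel numbers, used to say that a transduction can be computed -/

/-- Gödel number of a term.  There are no function symbols, so a term is a variable. -/
def termCode {Γ : Sig} {α : Type} [Encodable α] : Γ.lang.Term α → ℕ
  | .var a => Encodable.encode a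
  | .func f _ => Empty.elim f

/-- Gödel number of a formula. -/
def formulaCode {Γ : Sig} {α : Type} [Encodable α] :
    ∀ {n : ℕ}, Γ.lang.BoundedFormula α n → ℕ
  | _, .falsum => Nat.pair 0 0
  | _, .equal s t => Nat.pair 1 (Nat.pair (termCode s) (termCode t))
  | _, .rel (l := l) R ts =>
      Nat.pair 2 (Nat.pair l (Nat.pair (Fin.val (n := Γ l) R)
        (Encodable.encode (List.ofFn fun i => termCode (ts i)))))
  | _, .imp φ ψ => Nat.pair 3 (Nat.pair (formulaCode φ) (formulaCode ψ))
  | _, .all φ => Nat.pair 4 (formulaCode φ)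

/-- Gödel number of a transduction with a given input signature.  For an interpretation, the
formulas are listed by increasing arity, which also determines the output signature. -/
def Transduction.code : ∀ {Γ Δ : Sig}, Transduction Γ Δ → ℕ
  | _, _, .interp (Δ := Δ) φ =>
      Nat.pair 0 (Encodable.encode ((List.range (Δ.support.sup id + 1)).map fun n =>
        List.ofFn fun R : Fin (Δ n) => formulaCode (φ n R)))
  | _, _, .colour c => Nat.pair 1 c
  | _, _, .filter φ => Nat.pair 2 (formulaCode φ)
  | _, _, .restrict φ => Nat.pair 3 (formulaCode φ)
  | _, _, .copy m => Nat.pair 4 m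
  | _, _, .comp Φ Ψ => Nat.pair 5 (Nat.pair Φ.code Ψ.code)

/-! ### Directed graphs as structures -/

/-- The signature `{E}` with a single binary symbol. -/
noncomputable abbrev sigE : Sig := Finsupp.single 2 1

/-- The signature `{E, ≼}` with two binary symbols; the symbol of index `0` is `E`. -/
noncomputable abbrev sigELe : Sig := sigE + Finsupp.single 2 1

/-- The `{E}`-structure `(V, E)`. -/
def graphStr {V : Type} (E : V → V → Prop) : RelStr sigE :=
  ⟨V, fun n _ t => ∃ h : n = 2, E (t ⟨0, by omega⟩) (t ⟨1, by omega⟩)⟩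

/-- The `{E, ≼}`-structure `(V, E, ≼)`. -/
def graphLeStr {V : Type} (E le : V → V → Prop) : RelStr sigELe :=
  ⟨V, fun n R t => ∃ h : n = 2,
    if (R : ℕ) = 0 then E (t ⟨0, by omega⟩) (t ⟨1, by omega⟩)
    else le (t ⟨0, by omega⟩) (t ⟨1, by omega⟩)⟩

/-! ### Tournaments and cut-rank -/

/-- Tournaments: no loops, and exactly one of the two edges between any two distinct vertices. -/
structure IsTournament {V : Type} (E : V → V → Prop) : Prop where
  irrefl : ∀ x, ¬ E x x
  xor : ∀ x y, x ≠ y → Xor (E x y) (E y x)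

open Classical in
/-- Rank over the field with two elements of the adjacency matrix of `E` with rows restricted to
`X` and columns restricted to `Y`. -/
noncomputable def cutRank {V : Type} [Finite V] (E : V → V → Prop) (X Y : Set V) : ℕ :=
  letI : Fintype Y := Fintype.ofFinite Y
  (Matrix.of fun (x : X) (y : Y) => if E x y then (1 : ZMod 2) else 0).rank

/-! ### Bags -/

/-- A bag of order `k`. -/
structure Bag (k : ℕ) where
  /-- Internal vertices. -/
  V : Type
  finite : Finite V
  /-- Internal edges. -/
  adj : V → V → Prop
  tournament : IsTournament adj
  /-- The boundary bipartite tournament: `bdry i v` means `i → v`, its negation means `v → i`. -/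
  bdry : Fin k → V → Prop
  /-- Colouring of the internal vertices. -/
  col : V → Fin k
  /-- Recolouring function. -/
  recol : Fin k → Fin k

namespace Bag

variable {k : ℕ}

/-- Isomorphism of bags.  Bags are considered up to isomorphism; in particular, the product
below is then associative. -/
def Iso (A B : Bag k) : Prop :=
  ∃ e : A.V ≃ B.V,
    (∀ x y, A.adj x y ↔ B.adj (e x) (e y)) ∧ (∀ i x, A.bdry i x ↔ B.bdry i (e x)) ∧
    (∀ x, A.col x = B.col (e x)) ∧ A.recol = B.recol

/-- Internal edges of the product of two bags. -/
def mulAdj (A B : Bag k) : A.V ⊕ B.V → A.V ⊕ B.V → Prop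
  | .inl x, .inl y => A.adj x y
  | .inr x, .inr y => B.adj x y
  | .inl x, .inr y => B.bdry (A.col x) y
  | .inr y, .inl x => ¬ B.bdry (A.col x) y

theorem mulAdj_tournament (A B : Bag k) : IsTournament (mulAdj A B) := by
  constructor
  · rintro (x | x)
    · exact A.tournament.irrefl x
    · exact B.tournament.irrefl x
  · rintro (x | x) (y | y) h
    · exact A.tournament.xor x y (fun e => h (by rw [e]))
    · by_cases hb : B.bdry (A.col x) y <;> simp [mulAdj, hb, Xor]
    · by_cases hb : B.bdry (A.col y) x <;> simp [mulAdj, hb, Xor]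
    · exact B.tournament.xor x y (fun e => h (by rw [e]))

/-- The product of two bags, the first one being to the left of the second one. -/
def mul (A B : Bag k) : Bag k where
  V := A.V ⊕ B.V
  finite := by
    have := A.finite
    have := B.finite
    infer_instance
  adj := mulAdj A B
  tournament := mulAdj_tournament A B
  bdry := fun i v => Sum.elim (fun x => A.bdry i x) (fun y => B.bdry (A.recol i) y) v
  col := Sum.elim (fun x => B.recol (A.col x)) B.col
  recol := B.recol ∘ A.recol

/-- The empty bag with the identity recolouring. -/
def one (k : ℕ) : Bag k where
  V := Empty
  finite := inferInstance
  adj := fun _ _ => False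
  tournament := ⟨fun x => x.elim, fun x => x.elim⟩
  bdry := fun _ _ => False
  col := fun x => x.elim
  recol := id

/-- The product of a list of bags, from left to right. -/
def prod (L : List (Bag k)) : Bag k := L.foldr mul (one k)

/-- Atomic bags have at most one internal vertex. -/
def IsAtomic (B : Bag k) : Prop := Subsingleton B.V

/-- Membership in the submonoid generated by the atomic bags. -/
inductive InC : Bag k → Prop
  | one : InC (one k)
  | atomic {B : Bag k} : B.IsAtomic → InC B
  | mul {A B : Bag k} : InC A → InC B → InC (mul A B)
  | iso {A B : Bag k} : Iso A B → InC A → InC B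

/-! ### Types -/

/-- Vertex types: a colour, and the set of input vertices `i` with an edge from `i`. -/
abbrev VType (k : ℕ) : Type := Fin k × Set (Fin k)

/-- The type of a vertex in a bag. -/
def vtype (B : Bag k) (v : B.V) : VType k := (B.col v, {i | B.bdry i v})

/-- The vertex type `α` is inhabited in `B`. -/
def Inhab (B : Bag k) (α : VType k) : Prop := ∃ v, B.vtype v = α

/-- Types of bags. -/
@[ext]
structure BType (k : ℕ) where
  /-- The recolouring function. -/
  recol : Fin k → Fin k
  /-- The set of inhabited vertex types. -/
  inhab : Set (VType k)
  /-- The pairs of inhabited vertex types which are homogeneous with edges from the first to the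
  second.  Thus inhabited types `α`, `β` are homogeneous when `(α, β)` or `(β, α)` is here. -/
  arrow : Set (VType k × VType k)

/-- The type of a bag. -/
def type (B : Bag k) : BType k where
  recol := B.recol
  inhab := {α | B.Inhab α}
  arrow := {p | B.Inhab p.1 ∧ B.Inhab p.2 ∧
    ∀ u v, B.vtype u = p.1 → B.vtype v = p.2 → B.adj u v}

theorem vtype_mul_inl (A B : Bag k) (x : A.V) :
    (mul A B).vtype (Sum.inl x) = (B.recol (A.vtype x).1, (A.vtype x).2) := rfl

theorem vtype_mul_inr (A B : Bag k) (y : B.V) :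
    (mul A B).vtype (Sum.inr y) = ((B.vtype y).1, {i | A.recol i ∈ (B.vtype y).2}) := rfl

theorem inhab_of_type_eq {A A' : Bag k} (h : A.type = A'.type) (x : A'.V) :
    ∃ y : A.V, A.vtype y = A'.vtype x := by
  have h1 : A'.vtype x ∈ A'.type.inhab := ⟨x, rfl⟩
  rw [← h] at h1
  exact h1

theorem edge_of_type_eq {A A' : Bag k} (h : A.type = A'.type) {α β : VType k}
    (hE : ∀ u v, A.vtype u = α → A.vtype v = β → A.adj u v) (u v : A'.V)
    (hu : A'.vtype u = α) (hv : A'.vtype v = β) : A'.adj u v := by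
  obtain ⟨u', hu'⟩ := inhab_of_type_eq h u
  obtain ⟨v', hv'⟩ := inhab_of_type_eq h v
  have h1 : (α, β) ∈ A.type.arrow := ⟨⟨u', hu'.trans hu⟩, ⟨v', hv'.trans hv⟩, hE⟩
  rw [h] at h1
  exact h1.2.2 u v hu hv

theorem inhab_mul_congr {A A' B B' : Bag k} (hA : A.type = A'.type) (hB : B.type = B'.type)
    (x : (mul A' B').V) : ∃ y : (mul A B).V, (mul A B).vtype y = (mul A' B').vtype x := by
  have rA : A.recol = A'.recol := congrArg BType.recol hA
  have rB : B.recol = B'.recol := congrArg BType.recol hB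
  rcases x with x | x
  · obtain ⟨y, hy⟩ := inhab_of_type_eq hA x
    exact ⟨Sum.inl y, by rw [vtype_mul_inl, vtype_mul_inl, hy, rB]⟩
  · obtain ⟨y, hy⟩ := inhab_of_type_eq hB x
    exact ⟨Sum.inr y, by rw [vtype_mul_inr, vtype_mul_inr, hy, rA]⟩

theorem edge_mul_congr {A A' B B' : Bag k} (hA : A.type = A'.type) (hB : B.type = B'.type)
    {α β : VType k}
    (hE : ∀ u v, (mul A B).vtype u = α → (mul A B).vtype v = β → (mul A B).adj u v)
    (u v : (mul A' B').V) (hu : (mul A' B').vtype u = α) (hv : (mul A' B').vtype v = β) :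
    (mul A' B').adj u v := by
  have rA : A.recol = A'.recol := congrArg BType.recol hA
  have rB : B.recol = B'.recol := congrArg BType.recol hB
  have cross : ∀ (x : A.V) (x' : A'.V) (y : B.V) (y' : B'.V), A.vtype x = A'.vtype x' →
      B.vtype y = B'.vtype y' → (B.bdry (A.col x) y ↔ B'.bdry (A'.col x') y') := by
    intro x x' y y' h1 h2
    have e1 : A.col x = A'.col x' := congrArg Prod.fst h1
    have e2 : {i | B.bdry i y} = {i | B'.bdry i y'} := congrArg Prod.snd h2
    rw [e1]
    exact Set.ext_iff.1 e2 (A'.col x')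
  rcases u with u | u <;> rcases v with v | v
  · refine edge_of_type_eq hA (α := A'.vtype u) (β := A'.vtype v) ?_ u v rfl rfl
    intro a b ha hb
    refine hE (Sum.inl a) (Sum.inl b) ?_ ?_
    · rw [← hu, vtype_mul_inl, vtype_mul_inl, ha, rB]
    · rw [← hv, vtype_mul_inl, vtype_mul_inl, hb, rB]
  · obtain ⟨a, ha⟩ := inhab_of_type_eq hA u
    obtain ⟨b, hb⟩ := inhab_of_type_eq hB v
    refine (cross a u b v ha hb).1 (hE (Sum.inl a) (Sum.inr b) ?_ ?_)
    · rw [← hu, vtype_mul_inl, vtype_mul_inl, ha, rB]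
    · rw [← hv, vtype_mul_inr, vtype_mul_inr, hb, rA]
  · obtain ⟨a, ha⟩ := inhab_of_type_eq hA v
    obtain ⟨b, hb⟩ := inhab_of_type_eq hB u
    refine (not_congr (cross a v b u ha hb)).1 (hE (Sum.inr b) (Sum.inl a) ?_ ?_)
    · rw [← hu, vtype_mul_inr, vtype_mul_inr, hb, rA]
    · rw [← hv, vtype_mul_inl, vtype_mul_inl, ha, rB]
  · refine edge_of_type_eq hB (α := B'.vtype u) (β := B'.vtype v) ?_ u v rfl rfl
    intro a b ha hb
    refine hE (Sum.inr a) (Sum.inr b) ?_ ?_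
    · rw [← hu, vtype_mul_inr, vtype_mul_inr, ha, rA]
    · rw [← hv, vtype_mul_inr, vtype_mul_inr, hb, rA]

/-- The type of a product of two bags only depends on the types of the factors. -/
theorem type_mul_congr {A A' B B' : Bag k} (hA : A.type = A'.type) (hB : B.type = B'.type) :
    (mul A B).type = (mul A' B').type := by
  have hi : ∀ α, (mul A B).Inhab α ↔ (mul A' B').Inhab α := by
    intro α
    constructor
    · rintro ⟨x, hx⟩
      obtain ⟨y, hy⟩ := inhab_mul_congr hA.symm hB.symm x
      exact ⟨y, hy.trans hx⟩
    · rintro ⟨x, hx⟩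
      obtain ⟨y, hy⟩ := inhab_mul_congr hA hB x
      exact ⟨y, hy.trans hx⟩
  refine BType.ext ?_ ?_ ?_
  · have rA : A.recol = A'.recol := congrArg BType.recol hA
    have rB : B.recol = B'.recol := congrArg BType.recol hB
    change B.recol ∘ A.recol = B'.recol ∘ A'.recol
    rw [rA, rB]
  · exact Set.ext hi
  · ext p
    constructor
    · rintro ⟨h1, h2, h3⟩
      exact ⟨(hi _).1 h1, (hi _).1 h2, fun u v hu hv => edge_mul_congr hA hB h3 u v hu hv⟩
    · rintro ⟨h1, h2, h3⟩
      exact ⟨(hi _).2 h1, (hi _).2 h2,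
        fun u v hu hv => edge_mul_congr hA.symm hB.symm h3 u v hu hv⟩

/-- The type `τ` is idempotent, `τ * τ = τ`, for the product on types induced by the product of
bags (which is well defined by `type_mul_congr`). -/
def BType.IsIdem (τ : BType k) : Prop :=
  ∀ A B : Bag k, A.type = τ → B.type = τ → (mul A B).type = τ

/-! ### Factorisation forests -/

/-- `HasDepth B p q`: the bag `B` has a factorisation forest over `type` of depth at most `(p, q)`,
i.e. with at most `p` nested idempotent operations and at most `q` nested binary operations. -/
inductive HasDepth : Bag k → ℕ → ℕ → Prop
  | atomic {B : Bag k} {p q : ℕ} : B.IsAtomic → HasDepth B p q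
  | binary {A B : Bag k} {p q : ℕ} :
      HasDepth A p q → HasDepth B p q → HasDepth (mul A B) p (q + 1)
  | idem {L : List (Bag k)} {τ : BType k} {p q : ℕ} : L ≠ [] → τ.IsIdem →
      (∀ B ∈ L, B.type = τ) → (∀ B ∈ L, HasDepth B p q) → HasDepth (prod L) (p + 1) q
  | iso {A B : Bag k} {p q : ℕ} : Iso A B → HasDepth A p q → HasDepth B p q

/-- `B` has an idempotent factorisation of depth at most `(p, q)`: `B` is a product of bags of
`InC`, all with the same idempotent type and with factorisation depth at most `(p - 1, q)`. -/
def HasIdemFactorisation (B : Bag k) (p q : ℕ) : Prop :=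
  1 ≤ p ∧ ∃ (L : List (Bag k)) (τ : BType k), L ≠ [] ∧ τ.IsIdem ∧
    (∀ A ∈ L, A.type = τ) ∧ (∀ A ∈ L, InC A ∧ HasDepth A (p - 1) q) ∧ Iso (prod L) B

/-- The directed graph `(V, E)` is (isomorphic to) the internal tournament of `B`. -/
def IsInternal (B : Bag k) {V : Type} (E : V → V → Prop) : Prop :=
  ∃ e : V ≃ B.V, ∀ x y, E x y ↔ B.adj (e x) (e y)

end Bag

/-- `le` is a quasi-ordering whose equivalence classes are `X 0 ≼ X 1 ≼ … ≼ X (m - 1)`. -/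
structure IsQuasiOrderWithClasses {V : Type} (le : V → V → Prop) {m : ℕ} (X : Fin m → Set V) :
    Prop where
  nonempty : ∀ i, (X i).Nonempty
  partition : ∀ v, ∃! i, v ∈ X i
  le_iff : ∀ i j x y, x ∈ X i → y ∈ X j → (le x y ↔ i ≤ j)

end TournTrans

open TournTrans

namespace TournTrans

namespace Bag

variable {k : ℕ}

/-! ### Isomorphisms of bags -/

/-! The tournament is a product of factors of one idempotent type `τ`; a vertex `x` has a factor
number `blk x` and a type `vt x` in its factor. As the recolouring of `τ` is idempotent, an edge
between non-consecutive factors depends only on the two vertex types and on which factor comes first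
(`IsBlockProduct`).

If a pair of types is `Ordered`, such far edges reveal the order of the factors; once the factor
numbers modulo 5 are guessed, comparison of factors becomes definable with at most one intermediate
vertex (`baseLe_of_ordered`). If it is not, all far edges agree, so a deviating edge between
vertices of equal residue certifies that they share a factor (`blk_eq_of_baseLe`). Two types are
joined in `typeGraph` when one of these two mechanisms applies. Inside a connected component,
following a path of types compares factor numbers, and boundedly many squarings of the base relation
suffice (`iterate_baseLe_iff`). Between distinct components every edge is determined by the types
alone; for consecutive factors this uses that `τ` is idempotent (`edge_of_not_reachable`).

The quasi-ordering is lexicographic: component first, factor number second. A class is one factor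
restricted to one component, and restriction costs two binary products per idempotent level
(`HasDepth.restrict`). Across a cut, the row of `x` is determined by its colour and by whether `x`
lies in the last class before the cut, so the rank is at most `2 * k` (`cutRank_le`).

All guessed relations are unions of rectangles, one for each pair of a residue and a type. One
rectangle is guessed per round over a fixed signature, so only the number of rounds depends on `k`,
which makes the transduction computable (`graphLeStr_mem_orderTransduction`,
`primrec_code_orderTransduction`). -/

theorem Iso.refl (A : Bag k) : Iso A A :=
  ⟨Equiv.refl _, fun _ _ => Iff.rfl, fun _ _ => Iff.rfl, fun _ => rfl, rfl⟩

theorem Iso.symm {A B : Bag k} (h : Iso A B) : Iso B A := by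
  obtain ⟨e, h1, h2, h3, h4⟩ := h
  exact ⟨e.symm, fun x y => by simp [h1], fun i x => by simp [h2], fun x => by simp [h3], h4.symm⟩

theorem Iso.trans {A B C : Bag k} (h : Iso A B) (h' : Iso B C) : Iso A C := by
  obtain ⟨e, h1, h2, h3, h4⟩ := h
  obtain ⟨e', h1', h2', h3', h4'⟩ := h'
  exact ⟨e.trans e', fun x y => by simp [h1, h1'], fun i x => by simp [h2, h2'],
    fun x => by simp [h3, h3'], h4.trans h4'⟩

theorem Iso.mul {A A' B B' : Bag k} (hA : Iso A A') (hB : Iso B B') :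
    Iso (mul A B) (mul A' B') := by
  obtain ⟨e, h1, h2, h3, h4⟩ := hA
  obtain ⟨f, g1, g2, g3, g4⟩ := hB
  refine ⟨Equiv.sumCongr e f, ?_, ?_, ?_, ?_⟩
  · rintro (x | x) (y | y) <;> simp [Bag.mul, mulAdj, h1, h3, g1, g2] <;> rfl
  · rintro i (x | x) <;> simp [Bag.mul, h2, g2, h4] <;> rfl
  · rintro (x | x) <;> simp [Bag.mul, h3, g3, g4] <;> rfl
  · simp [Bag.mul, h4, g4]

theorem mul_assoc_iso (A B C : Bag k) : Iso (mul (mul A B) C) (mul A (mul B C)) := by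
  refine ⟨Equiv.sumAssoc _ _ _, ?_, ?_, ?_, rfl⟩
  · rintro ((x | x) | x) ((y | y) | y) <;> exact Iff.rfl
  · rintro i ((x | x) | x) <;> exact Iff.rfl
  · rintro ((x | x) | x) <;> rfl

theorem one_mul_iso (A : Bag k) : Iso (mul (one k) A) A := by
  refine ⟨Equiv.emptySum Empty _, ?_, ?_, ?_, rfl⟩
  · rintro (x | x) (y | y)
    · exact x.elim
    · exact x.elim
    · exact y.elim
    · exact Iff.rfl
  · rintro i (x | x)
    · exact x.elim
    · exact Iff.rfl
  · rintro (x | x)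
    · exact x.elim
    · rfl

theorem mul_one_iso (A : Bag k) : Iso (mul A (one k)) A := by
  refine ⟨Equiv.sumEmpty _ Empty, ?_, ?_, ?_, rfl⟩
  · rintro (x | x) (y | y)
    · exact Iff.rfl
    · exact y.elim
    · exact x.elim
    · exact x.elim
  · rintro i (x | x)
    · exact Iff.rfl
    · exact x.elim
  · rintro (x | x)
    · rfl
    · exact x.elim

theorem Iso.type_eq {A B : Bag k} (h : Iso A B) : A.type = B.type := by
  obtain ⟨e, h1, h2, h3, h4⟩ := h
  have hv : ∀ x, B.vtype (e x) = A.vtype x := fun x => by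
    simp [vtype, h2, h3]
  have hi : ∀ α, A.Inhab α ↔ B.Inhab α := fun α =>
    ⟨fun ⟨x, hx⟩ => ⟨e x, by rw [hv, hx]⟩, fun ⟨x, hx⟩ => ⟨e.symm x, by rw [← hv]; simpa⟩⟩
  refine BType.ext h4 (Set.ext hi) (Set.ext fun p => ?_)
  change (A.Inhab _ ∧ A.Inhab _ ∧ _) ↔ (B.Inhab _ ∧ B.Inhab _ ∧ _)
  rw [hi, hi]
  refine and_congr_right' (and_congr_right' ⟨fun h u v hu hv' => ?_, fun h u v hu hv' => ?_⟩)
  · have := h (e.symm u) (e.symm v) (by rw [← hv]; simpa) (by rw [← hv]; simpa)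
    simpa [h1] using this
  · exact (h1 _ _).2 (h (e u) (e v) (by rw [hv, hu]) (by rw [hv, hv']))

/-! ### Restrictions of bags to sets of vertex types -/

/-- The restriction of a bag to the vertices whose types are in `J`. -/
def restrict (B : Bag k) (J : Set (VType k)) : Bag k where
  V := {v : B.V // B.vtype v ∈ J}
  finite := by
    have := B.finite
    infer_instance
  adj := fun x y => B.adj x y
  tournament := ⟨fun x => B.tournament.irrefl x,
    fun x y h => B.tournament.xor x y (fun e => h (Subtype.ext e))⟩
  bdry := fun i x => B.bdry i x
  col := fun x => B.col x
  recol := B.recol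

theorem Iso.restrict {A B : Bag k} (h : Iso A B) (J : Set (VType k)) :
    Iso (A.restrict J) (B.restrict J) := by
  obtain ⟨e, h1, h2, h3, h4⟩ := h
  have hv : ∀ x, B.vtype (e x) = A.vtype x := fun x => by
    simp [vtype, h2, h3]
  exact ⟨e.subtypeEquiv fun x => by rw [hv], fun x y => h1 _ _, fun i x => h2 _ _,
    fun x => h3 _, h4⟩

/-- The vertex types of the left factor which become elements of `J` when multiplied by a bag with
recolouring `r`. -/
def leftPull (r : Fin k → Fin k) (J : Set (VType k)) : Set (VType k) :=
  {α | (r α.1, α.2) ∈ J}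

/-- The vertex types of the right factor which become elements of `J` when multiplied by a bag
with recolouring `r`. -/
def rightPull (r : Fin k → Fin k) (J : Set (VType k)) : Set (VType k) :=
  {α | (α.1, {i | r i ∈ α.2}) ∈ J}

/-- A vertex type changes when its bag becomes a factor: colours on the left are recoloured by `B`,
and boundaries on the right are read through the recolouring of `A`. Hence `J` is pulled back
differently on each side. -/
theorem restrict_mul_iso (A B : Bag k) (J : Set (VType k)) :
    Iso (mul (A.restrict (leftPull B.recol J)) (B.restrict (rightPull A.recol J)))
      ((mul A B).restrict J) := by
  refine ⟨⟨Sum.elim (fun x => ⟨Sum.inl x.1, x.2⟩) (fun x => ⟨Sum.inr x.1, x.2⟩),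
    fun | ⟨.inl x, h⟩ => Sum.inl ⟨x, h⟩
        | ⟨.inr x, h⟩ => Sum.inr ⟨x, h⟩, ?_, ?_⟩, ?_, ?_, ?_, rfl⟩
  · rintro (x | x) <;> rfl
  · rintro ⟨x | x, h⟩ <;> rfl
  · rintro (x | x) (y | y) <;> exact Iff.rfl
  · rintro i (x | x) <;> exact Iff.rfl
  · rintro (x | x) <;> rfl

theorem type_restrict_congr {A B : Bag k} (h : A.type = B.type) (J : Set (VType k)) :
    (A.restrict J).type = (B.restrict J).type := by
  have aux : ∀ {A B : Bag k}, A.type = B.type → ∀ α, (A.restrict J).Inhab α →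
      (B.restrict J).Inhab α := by
    rintro A B h α ⟨⟨x, hx⟩, rfl⟩
    obtain ⟨y, hy⟩ := inhab_of_type_eq h.symm x
    exact ⟨⟨y, by rw [hy]; exact hx⟩, hy⟩
  have aux2 : ∀ {A B : Bag k}, A.type = B.type → ∀ p, p ∈ (A.restrict J).type.arrow →
      p ∈ (B.restrict J).type.arrow := by
    rintro A B h p ⟨h1, h2, h3⟩
    refine ⟨aux h _ h1, aux h _ h2, fun u v hu hv => ?_⟩
    have hu' : p.1 ∈ J := hu ▸ u.2
    have hv' : p.2 ∈ J := hv ▸ v.2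
    exact edge_of_type_eq h (α := p.1) (β := p.2)
      (fun a b ha hb => h3 ⟨a, by rw [ha]; exact hu'⟩ ⟨b, by rw [hb]; exact hv'⟩ ha hb) u.1 v.1 hu hv
  exact BType.ext (congrArg BType.recol h :) (Set.ext fun α => ⟨aux h α, aux h.symm α⟩)
    (Set.ext fun p => ⟨aux2 h p, aux2 h.symm p⟩)

/-! ### Factorisation depth -/

theorem HasDepth.succ_left {B : Bag k} {p q : ℕ} (h : HasDepth B p q) : HasDepth B (p + 1) q := by
  induction h with
  | atomic h => exact .atomic h
  | binary _ _ ih1 ih2 => exact .binary ih1 ih2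
  | idem h1 h2 h3 _ ih => exact .idem h1 h2 h3 ih
  | iso h _ ih => exact .iso h ih

theorem HasDepth.succ_right {B : Bag k} {p q : ℕ} (h : HasDepth B p q) : HasDepth B p (q + 1) := by
  induction h with
  | atomic h => exact .atomic h
  | binary _ _ ih1 ih2 => exact .binary ih1 ih2
  | idem h1 h2 h3 _ ih => exact .idem h1 h2 h3 ih
  | iso h _ ih => exact .iso h ih

theorem HasDepth.mono_right {B : Bag k} {p q q' : ℕ} (h : HasDepth B p q) (hq : q ≤ q') :
    HasDepth B p q' := by
  induction hq with
  | refl => exact h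
  | step _ ih => exact ih.succ_right

theorem HasDepth.inC {B : Bag k} {p q : ℕ} (h : HasDepth B p q) : InC B := by
  induction h with
  | atomic h => exact .atomic h
  | binary _ _ ih1 ih2 => exact .mul ih1 ih2
  | @idem L _ _ _ _ _ _ _ ih =>
    clear * - ih
    induction L with
    | nil => exact .one
    | cons A L ihL =>
      exact .mul (ih A (by simp)) (ihL fun B hB => ih B (by simp [hB]))
  | iso h _ ih => exact .iso h ih

theorem recol_idem_of_isIdem {τ : BType k} (hτ : τ.IsIdem) {A : Bag k} (hA : A.type = τ)
    (c : Fin k) : τ.recol (τ.recol c) = τ.recol c := by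
  have h := congrArg BType.recol (hτ A A hA hA)
  subst hA
  exact congrFun h c

theorem recol_prod {r : Fin k → Fin k} (hr : ∀ c, r (r c) = r c) (L : List (Bag k))
    (hL : ∀ B ∈ L, B.recol = r) (hne : L ≠ []) : (prod L).recol = r := by
  induction L with
  | nil => exact absurd rfl hne
  | cons A L ih =>
    change (prod L).recol ∘ A.recol = r
    rw [hL A (by simp)]
    rcases L with _ | ⟨B, L⟩
    · rfl
    · rw [ih (fun B hB => hL B (by simp [hB])) (by simp)]
      exact funext hr

theorem rightPull_rightPull {r : Fin k → Fin k} (hr : ∀ c, r (r c) = r c) (J : Set (VType k)) :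
    rightPull r (rightPull r J) = rightPull r J := by
  ext α
  simp [rightPull, hr]

/-- Restriction of a product of bags, when no left end of an idempotent product is involved. -/
theorem restrict_prod_concat_iso {r : Fin k → Fin k} (hr : ∀ c, r (r c) = r c)
    {J : Set (VType k)} (hJ : rightPull r J = J) (Z : Bag k) (hZ : Z.recol = r)
    (L : List (Bag k)) (hL : ∀ B ∈ L, B.recol = r) :
    Iso ((prod (L ++ [Z])).restrict J)
      (mul (prod (L.map fun B => B.restrict (leftPull r J))) (Z.restrict J)) := by
  induction L with
  | nil => exact ((mul_one_iso Z).restrict J).trans (one_mul_iso _).symm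
  | cons A L ih =>
    have ih := ih fun B hB => hL B (by simp [hB])
    have h := (restrict_mul_iso A (prod (L ++ [Z])) J).symm
    have e : (prod (L ++ [Z])).recol = r := recol_prod hr _ (by
      intro B hB
      rcases List.mem_append.1 hB with hB | hB
      · exact hL B (by simp [hB])
      · rw [List.mem_singleton.1 hB, hZ]) (by simp)
    rw [e, hL A (by simp), hJ] at h
    exact h.trans (((Iso.refl _).mul ih).trans (mul_assoc_iso _ _ _).symm)

/-- Since `J` is invariant under both pullbacks, restricting commutes with squaring `A`, and the
type of a restriction depends only on the type of the bag. -/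
theorem isIdem_restrict {τ : BType k} (hτ : τ.IsIdem) {A : Bag k} (hA : A.type = τ)
    (J : Set (VType k)) (hJl : leftPull τ.recol J = J) (hJr : rightPull τ.recol J = J) :
    (A.restrict J).type.IsIdem := by
  intro B C hB hC
  rw [type_mul_congr hB hC]
  have hr : A.recol = τ.recol := congrArg BType.recol hA
  have h := (restrict_mul_iso A A J).type_eq
  rw [hr, hJl, hJr] at h
  rw [h]
  exact type_restrict_congr ((hτ A A hA hA).trans hA.symm) J

/-- Restricting to a set of vertex types only increases the binary depth. -/
theorem HasDepth.restrict {B : Bag k} {p q : ℕ} (h : HasDepth B p q) (J : Set (VType k)) :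
    HasDepth (B.restrict J) p (q + 2 * p) := by
  induction h generalizing J with
  | atomic h =>
    have : Subsingleton _ := h
    exact .atomic (inferInstanceAs (Subsingleton {v // _}))
  | @binary A B p q _ _ ihA ihB =>
    have := HasDepth.iso (restrict_mul_iso A B J) (.binary (ihA _) (ihB _))
    exact this.mono_right (by omega)
  | iso h _ ih => exact .iso (h.restrict J) (ih J)
  | @idem L τ p q hne hτ hL _ ih =>
    rcases L with _ | ⟨A, T⟩
    · exact absurd rfl hne
    have hr : ∀ B ∈ A :: T, B.recol = τ.recol := fun B hB => congrArg BType.recol (hL B hB)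
    have hrr := recol_idem_of_isIdem hτ (hL A (by simp))
    -- The first and last factors are split off, because there `J` is pulled back on one side only.
    -- The two binary products this takes account for the 2 in `q + 2 * p`.
    refine .iso (restrict_mul_iso A (prod T) J)
      (.binary (q := q + 2 * p + 1) ((ih A (by simp) _).succ_left.mono_right (by omega)) ?_)
    rw [hr A (by simp)]
    rcases List.eq_nil_or_concat' T with rfl | ⟨M, Z, rfl⟩
    · exact .atomic ⟨fun x => x.1.elim⟩
    refine .iso (restrict_prod_concat_iso hrr (rightPull_rightPull hrr J) Z (hr Z (by simp)) M
      fun B hB => hr B (by simp [hB])).symm (.binary ?_ (ih Z (by simp) _).succ_left)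
    rcases M with _ | ⟨D, M⟩
    · exact .atomic (inferInstanceAs (Subsingleton Empty))
    have hD : D.type = τ := hL D (by simp)
    -- All middle factors are restricted to the same set, pulled back from both sides and therefore
    -- invariant under both pullbacks, so they still share one idempotent type.
    refine .idem (τ := (D.restrict (leftPull τ.recol (rightPull τ.recol J))).type) (by simp)
      (isIdem_restrict hτ hD _ ?_ ?_) ?_ ?_
    · ext α
      simp [leftPull, rightPull, hrr]
    · ext α
      simp [leftPull, rightPull, hrr]
    · intro B hB
      obtain ⟨C, hC, rfl⟩ := List.mem_map.1 hB
      exact type_restrict_congr ((hL C (List.mem_cons_of_mem _ (List.mem_append_left _ hC))).trans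
        hD.symm) _
    · intro B hB
      obtain ⟨C, hC, rfl⟩ := List.mem_map.1 hB
      exact ih C (List.mem_cons_of_mem _ (List.mem_append_left _ hC)) _

end Bag

end TournTrans

/-! ### Products of bags of one idempotent type, seen on the vertex set -/

namespace TournTrans

/-- The tournament `E` is a product of `n` bags of the same idempotent type `τ`: the vertex `x`
belongs to the factor number `blk x`, and has type `vt x` in that factor. -/
structure IsBlockProduct {k : ℕ} {V : Type} (E : V → V → Prop) (τ : Bag.BType k) (n : ℕ)
    (blk : V → ℕ) (vt : V → Bag.VType k) : Prop where
  tournament : IsTournament E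
  recol_idem : ∀ c, τ.recol (τ.recol c) = τ.recol c
  blk_lt : ∀ x, blk x < n
  vt_mem : ∀ x, vt x ∈ τ.inhab
  surj : ∀ i < n, ∀ α ∈ τ.inhab, ∃ x, blk x = i ∧ vt x = α
  near : ∀ x y, blk x + 1 = blk y → (E x y ↔ (vt x).1 ∈ (vt y).2)
  far : ∀ x y, blk x + 1 < blk y → (E x y ↔ τ.recol (vt x).1 ∈ (vt y).2)
  arrow : ∀ i < n, ∀ α ∈ τ.inhab, ∀ β ∈ τ.inhab, ((α, β) ∈ τ.arrow ↔
    ∀ x y, blk x = i → blk y = i → vt x = α → vt y = β → E x y)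
  -- The last four fields record `τ * τ = τ`: a vertex of type `α` in the left factor and one of
  -- type `β` in the right factor acquire these new types in the product, which again has type `τ`.
  mem_left : ∀ α ∈ τ.inhab, (τ.recol α.1, α.2) ∈ τ.inhab
  mem_right : ∀ α ∈ τ.inhab, (α.1, {i | τ.recol i ∈ α.2}) ∈ τ.inhab
  near_of_arrow : ∀ α ∈ τ.inhab, ∀ β ∈ τ.inhab,
    ((τ.recol α.1, α.2), (β.1, {i | τ.recol i ∈ β.2})) ∈ τ.arrow → α.1 ∈ β.2
  not_near_of_arrow : ∀ α ∈ τ.inhab, ∀ β ∈ τ.inhab,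
    ((β.1, {i | τ.recol i ∈ β.2}), (τ.recol α.1, α.2)) ∈ τ.arrow → α.1 ∉ β.2

namespace Bag

variable {k : ℕ}

/-- The index of the factor to which a vertex of a product belongs. -/
def block : (L : List (Bag k)) → (prod L).V → ℕ
  | [], v => Empty.elim v
  | A :: L, v => Sum.elim (fun _ : A.V => 0) (fun y => block L y + 1) v

/-- The type of a vertex of a product in its factor. -/
def blockType : (L : List (Bag k)) → (prod L).V → VType k
  | [], v => Empty.elim v
  | A :: L, v => Sum.elim (fun x : A.V => A.vtype x) (fun y => blockType L y) v

theorem block_lt (L : List (Bag k)) (v : (prod L).V) : block L v < L.length := by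
  induction L with
  | nil => exact v.elim
  | cons A L ih =>
    rcases v with x | y
    · exact Nat.succ_pos _
    · exact Nat.succ_lt_succ (ih y)

theorem exists_block_embedding (L : List (Bag k)) (i : ℕ) (A : Bag k) (h : L[i]? = some A) :
    ∃ f : A.V → (prod L).V, Function.Injective f ∧ (∀ v, block L v = i ↔ ∃ x, f x = v) ∧
      (∀ x y, A.adj x y ↔ (prod L).adj (f x) (f y)) ∧ ∀ x, blockType L (f x) = A.vtype x := by
  induction L generalizing i with
  | nil => simp at h
  | cons D L ih =>
    rcases i with _ | i
    · obtain rfl : D = A := by simpa using h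
      refine ⟨Sum.inl, Sum.inl_injective, ?_, fun _ _ => Iff.rfl, fun _ => rfl⟩
      rintro (x | y)
      · exact ⟨fun _ => ⟨x, rfl⟩, fun _ => rfl⟩
      · exact ⟨fun h => absurd h (Nat.succ_ne_zero _), fun ⟨x, hx⟩ => by cases hx⟩
    · obtain ⟨f, h1, h2, h3, h4⟩ := ih i (by simpa using h)
      refine ⟨Sum.inr ∘ f, Sum.inr_injective.comp h1, ?_, h3, h4⟩
      rintro (x | y)
      · exact ⟨fun h => absurd h.symm (Nat.succ_ne_zero _), fun ⟨x, hx⟩ => by cases hx⟩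
      · refine (Nat.succ_inj (a := block L y) (b := i)).trans ((h2 y).trans ?_)
        exact exists_congr fun x => Sum.inr_injective.eq_iff.symm

/-- A colour is recoloured once per factor that it crosses; by idempotency only whether it crosses
none matters. -/
theorem bdry_prod {r : Fin k → Fin k} (hr : ∀ c, r (r c) = r c) (L : List (Bag k))
    (hL : ∀ B ∈ L, B.recol = r) (c : Fin k) (v : (prod L).V) :
    (prod L).bdry c v ↔ (if block L v = 0 then c else r c) ∈ (blockType L v).2 := by
  induction L generalizing c with
  | nil => exact v.elim
  | cons A L ih =>
    rcases v with x | y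
    · exact Iff.rfl
    · change (prod L).bdry (A.recol c) y ↔ (if block L y + 1 = 0 then c else r c) ∈
        (blockType L y).2
      refine (ih (fun B hB => hL B (by simp [hB])) _ y).trans ?_
      rw [hL A (by simp), hr]
      simp

theorem adj_prod {r : Fin k → Fin k} (hr : ∀ c, r (r c) = r c) (L : List (Bag k))
    (hL : ∀ B ∈ L, B.recol = r) (u v : (prod L).V) (h : block L u < block L v) :
    (prod L).adj u v ↔
      (if block L u + 1 = block L v then (blockType L u).1 else r (blockType L u).1) ∈
        (blockType L v).2 := by
  induction L with
  | nil => exact v.elim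
  | cons A L ih =>
    have hL' : ∀ B ∈ L, B.recol = r := fun B hB => hL B (by simp [hB])
    rcases u with x | x <;> rcases v with y | y
    · exact absurd h (lt_irrefl _)
    · change (prod L).bdry (A.col x) y ↔ (if 0 + 1 = block L y + 1 then A.col x
        else r (A.col x)) ∈ (blockType L y).2
      refine (bdry_prod hr L hL' _ y).trans ?_
      simp [eq_comm]
    · exact absurd h (Nat.not_lt_zero _)
    · have h' : block L x < block L y := Nat.lt_of_succ_lt_succ h
      refine (ih hL' x y h').trans ?_
      change _ ↔ (if block L x + 1 + 1 = block L y + 1 then (blockType L x).1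
        else r (blockType L x).1) ∈ (blockType L y).2
      simp

theorem isBlockProduct_prod (L : List (Bag k)) {τ : BType k} (hne : L ≠ []) (hτ : τ.IsIdem)
    (hL : ∀ A ∈ L, A.type = τ) :
    IsBlockProduct (prod L).adj τ L.length (block L) (blockType L) := by
  obtain ⟨A, hA⟩ := List.exists_mem_of_ne_nil L hne
  have hA := hL A hA
  have hr := recol_idem_of_isIdem hτ hA
  have hL' : ∀ B ∈ L, B.recol = τ.recol := fun B hB => congrArg BType.recol (hL B hB)
  have get : ∀ i < L.length, ∃ A, L[i]? = some A ∧ A.type = τ := fun i hi =>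
    ⟨L[i], List.getElem?_eq_getElem hi, hL _ (List.getElem_mem hi)⟩
  -- The fields expressing idempotency are read off in `mul A A`, even when `L` has a single factor.
  have hAA := hτ A A hA hA
  have inh : ∀ α ∈ τ.inhab, ∃ x, A.vtype x = α := fun α hα => by
    rw [← hA] at hα
    exact hα
  have rA : A.recol = τ.recol := congrArg BType.recol hA
  refine ⟨(prod L).tournament, hr, block_lt L, fun x => ?_, fun i hi α hα => ?_,
    fun x y h => ?_, fun x y h => ?_, fun i hi α hα β hβ => ?_, fun α hα => ?_, fun α hα => ?_,
    fun α hα β hβ h => ?_, fun α hα β hβ h => ?_⟩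
  · obtain ⟨D, hD, hDτ⟩ := get _ (block_lt L x)
    obtain ⟨f, -, h2, -, h4⟩ := exists_block_embedding L _ D hD
    obtain ⟨y, hy⟩ := (h2 x).1 rfl
    rw [← hDτ, ← hy, h4]
    exact ⟨y, rfl⟩
  · obtain ⟨D, hD, hDτ⟩ := get i hi
    obtain ⟨f, -, h2, -, h4⟩ := exists_block_embedding L _ D hD
    rw [← hDτ] at hα
    obtain ⟨y, hy⟩ := hα
    exact ⟨f y, (h2 _).2 ⟨y, rfl⟩, (h4 y).trans hy⟩
  · rw [adj_prod hr L hL' x y (by omega), if_pos h]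
  · rw [adj_prod hr L hL' x y (by omega), if_neg (by omega)]
  · obtain ⟨D, hD, hDτ⟩ := get i hi
    obtain ⟨f, -, h2, h3, h4⟩ := exists_block_embedding L _ D hD
    rw [← hDτ] at hα hβ ⊢
    constructor
    · rintro ⟨-, -, h⟩ x y hx hy hxα hyβ
      obtain ⟨x, rfl⟩ := (h2 x).1 hx
      obtain ⟨y, rfl⟩ := (h2 y).1 hy
      exact (h3 x y).1 (h x y ((h4 x).symm.trans hxα) ((h4 y).symm.trans hyβ))
    · intro h
      exact ⟨hα, hβ, fun u v hu hv => (h3 u v).2 (h _ _ ((h2 _).2 ⟨u, rfl⟩) ((h2 _).2 ⟨v, rfl⟩)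
        ((h4 u).trans hu) ((h4 v).trans hv))⟩
  · obtain ⟨x, rfl⟩ := inh α hα
    rw [← rA, ← hAA]
    exact ⟨Sum.inl x, rfl⟩
  · obtain ⟨x, rfl⟩ := inh α hα
    rw [← rA, ← hAA]
    exact ⟨Sum.inr x, rfl⟩
  · obtain ⟨x, rfl⟩ := inh α hα
    obtain ⟨y, rfl⟩ := inh β hβ
    rw [← rA, ← hAA] at h
    exact h.2.2 (Sum.inl x) (Sum.inr y) rfl rfl
  · obtain ⟨x, rfl⟩ := inh α hα
    obtain ⟨y, rfl⟩ := inh β hβ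
    rw [← rA, ← hAA] at h
    exact h.2.2 (Sum.inr y) (Sum.inl x) rfl rfl

end Bag

theorem IsBlockProduct.comp_equiv {k : ℕ} {V W : Type} {E : V → V → Prop} {F : W → W → Prop}
    {τ : Bag.BType k} {n : ℕ} {blk : W → ℕ} {vt : W → Bag.VType k}
    (h : IsBlockProduct F τ n blk vt) (e : V ≃ W) (he : ∀ x y, E x y ↔ F (e x) (e y)) :
    IsBlockProduct E τ n (blk ∘ e) (vt ∘ e) where
  tournament := ⟨fun x hx => h.tournament.irrefl (e x) ((he x x).1 hx), fun x y hxy => by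
    rw [he, he]
    exact h.tournament.xor _ _ (e.injective.ne hxy)⟩
  recol_idem := h.recol_idem
  blk_lt x := h.blk_lt _
  vt_mem x := h.vt_mem _
  surj i hi α hα := by
    obtain ⟨x, hx⟩ := h.surj i hi α hα
    exact ⟨e.symm x, by simpa using hx⟩
  near x y hxy := (he x y).trans (h.near _ _ hxy)
  far x y hxy := (he x y).trans (h.far _ _ hxy)
  arrow i hi α hα β hβ := by
    rw [h.arrow i hi α hα β hβ, ← e.forall_congr_right]
    refine forall_congr' fun x => ?_
    rw [← e.forall_congr_right]
    exact forall_congr' fun y => by rw [he]; rfl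
  mem_left := h.mem_left
  mem_right := h.mem_right
  near_of_arrow := h.near_of_arrow
  not_near_of_arrow := h.not_near_of_arrow

/-- The second half serves the classes of the quasi-ordering, where `J` will be a component of
`typeGraph`. -/
theorem Bag.HasIdemFactorisation.exists_isBlockProduct {k p q : ℕ} {V : Type} {E : V → V → Prop}
    {B : Bag k} (hB : B.HasIdemFactorisation p q) (hE : B.IsInternal E) :
    ∃ (τ : BType k) (n : ℕ) (blk : V → ℕ) (vt : V → VType k), IsBlockProduct E τ n blk vt ∧
      ∀ i < n, ∀ (J : Set (VType k)) (X : Set V), (∀ x, x ∈ X ↔ blk x = i ∧ vt x ∈ J) →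
        ∃ C : Bag k, C.HasDepth (p - 1) (q + 2 * (p - 1)) ∧
          C.IsInternal (fun x y : X => E x y) := by
  obtain ⟨-, L, τ, hne, hτ, hL, hd, f, hf, -⟩ := hB
  obtain ⟨e, he⟩ := hE
  have hg : ∀ x y, E x y ↔ (prod L).adj ((e.trans f.symm) x) ((e.trans f.symm) y) := fun x y => by
    rw [he, hf]
    simp
  generalize e.trans f.symm = g at hg
  refine ⟨τ, L.length, block L ∘ g, blockType L ∘ g,
    (isBlockProduct_prod L hne hτ hL).comp_equiv g hg, fun i hi J X hX => ?_⟩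
  obtain ⟨s, h1, h2, h3, h4⟩ := exists_block_embedding L i _ (List.getElem?_eq_getElem hi)
  have hm : ∀ v : (L[i].restrict J).V, g.symm (s v.1) ∈ X := fun v => by
    rw [hX]
    refine ⟨?_, ?_⟩
    · simpa using (h2 _).2 ⟨v.1, rfl⟩
    · simpa [h4] using v.2
  let t : (L[i].restrict J).V ≃ X := Equiv.ofBijective (fun v => ⟨g.symm (s v.1), hm v⟩) (by
    constructor
    · intro u v huv
      exact Subtype.ext (h1 (g.symm.injective (congrArg Subtype.val huv)))
    · rintro ⟨x, hx⟩
      have hx' := (hX x).1 hx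
      obtain ⟨v, hv⟩ := (h2 (g x)).1 hx'.1
      refine ⟨⟨v, ?_⟩, Subtype.ext (by simp [hv])⟩
      rw [← h4, hv]
      exact hx'.2)
  refine ⟨L[i].restrict J, (hd _ (List.getElem_mem hi)).2.restrict J, t.symm, fun x y => ?_⟩
  obtain ⟨u, rfl⟩ := t.surjective x
  obtain ⟨v, rfl⟩ := t.surjective y
  rw [Equiv.symm_apply_apply, Equiv.symm_apply_apply]
  change E (g.symm (s u.1)) (g.symm (s v.1)) ↔ L[i].adj u.1 v.1
  rw [hg, h3, Equiv.apply_symm_apply, Equiv.apply_symm_apply]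

end TournTrans

/-! ### The graph of vertex types and the definable comparison of factors -/

namespace TournTrans

namespace Bag.BType

variable {k : ℕ} (τ : BType k)

/-- In a product of bags of type `τ`, there is an edge from every vertex of type `α` to every
vertex of type `β` in a later, non-consecutive factor. -/
def Fwd (α β : VType k) : Prop := τ.recol α.1 ∈ β.2

/-- The edges between vertices of types `α` and `β` in non-consecutive factors of a product of bags
of type `τ` determine the order of these factors. -/
def Ordered (α β : VType k) : Prop := τ.Fwd α β ↔ τ.Fwd β α

variable {τ} in
theorem Ordered.symm {α β : VType k} (h : τ.Ordered α β) : τ.Ordered β α := Iff.symm h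

/-- Two vertex types are adjacent if the edges between vertices of these types determine the order
of non-consecutive factors, or allow to recognise that two vertices are in the same factor. -/
def typeGraph : SimpleGraph (VType k) where
  Adj α β := α ≠ β ∧ α ∈ τ.inhab ∧ β ∈ τ.inhab ∧ (τ.Ordered α β ∨
    (τ.Fwd α β ∧ (α, β) ∉ τ.arrow) ∨ (τ.Fwd β α ∧ (β, α) ∉ τ.arrow))
  symm := ⟨fun _ _ h => ⟨h.1.symm, h.2.2.1, h.2.1, h.2.2.2.imp Ordered.symm Or.symm⟩⟩
  loopless := ⟨fun _ h => h.1 rfl⟩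

end Bag.BType

section Relations

variable {k : ℕ} {V : Type} (E : V → V → Prop) (τ : Bag.BType k) (blk : V → ℕ)
  (vt : V → Bag.VType k)

/-- Pairs of vertices of ordered types which are certainly in distinct and non-consecutive
factors, since the indices of their factors differ by `2` or `3` modulo `5`. -/
def FarPair (x y : V) : Prop :=
  τ.Ordered (vt x) (vt y) ∧ (blk y % 5 = (blk x + 2) % 5 ∨ blk y % 5 = (blk x + 3) % 5)

/-- The order of the factors of two vertices which form a far pair. -/
def FarLt (x y : V) : Prop :=
  ((FarPair τ blk vt x y ∧ τ.Fwd (vt x) (vt y)) ∧ E x y) ∨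
    ((FarPair τ blk vt x y ∧ ¬ τ.Fwd (vt x) (vt y)) ∧ ¬ E x y)

/-- The order of the factors of two vertices whose types are equal or adjacent, as far as it is
visible from the edges and from the indices of the factors modulo `5`. -/
def BaseLe (x y : V) : Prop :=
  (τ.Ordered (vt x) (vt y) ∧ ¬ (FarLt E τ blk vt y x ∨
    Relation.Comp (FarLt E τ blk vt) (FarLt E τ blk vt) y x ∨
    ((τ.Ordered (vt y) (vt x) ∧ blk x % 5 = (blk y + 1) % 5) ∧
      ¬ Relation.Comp (FarLt E τ blk vt) (FarLt E τ blk vt) x y))) ∨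
  ((¬ τ.Ordered (vt x) (vt y) ∧ blk x % 5 = blk y % 5 ∧ τ.Fwd (vt x) (vt y)) ∧ ¬ E x y) ∨
  ((¬ τ.Ordered (vt x) (vt y) ∧ blk x % 5 = blk y % 5 ∧ ¬ τ.Fwd (vt x) (vt y)) ∧ E x y)

end Relations

theorem IsTournament.not_iff {V : Type} {E : V → V → Prop} (h : IsTournament E) {x y : V}
    (hxy : x ≠ y) : ¬ E x y ↔ E y x := by
  have := h.xor x y hxy
  unfold Xor at this
  tauto

namespace IsBlockProduct

variable {k : ℕ} {V : Type} {E : V → V → Prop} {τ : Bag.BType k} {n : ℕ} {blk : V → ℕ}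
  {vt : V → Bag.VType k}

theorem far' (h : IsBlockProduct E τ n blk vt) {x y : V} (hxy : blk y + 1 < blk x) :
    E x y ↔ ¬ τ.Fwd (vt y) (vt x) := by
  rw [Bag.BType.Fwd, ← h.far y x hxy, h.tournament.not_iff]
  rintro rfl
  omega

/-- Residues differing by 2 or 3 modulo 5 force the factors to be at distance at least 2. The
direction of the edge is then given by `Fwd`, and for ordered types it flips with the order of the
factors. -/
theorem farLt_iff (h : IsBlockProduct E τ n blk vt) (x y : V) :
    FarLt E τ blk vt x y ↔ FarPair τ blk vt x y ∧ blk x < blk y := by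
  have key : FarPair τ blk vt x y → ((E x y ↔ τ.Fwd (vt x) (vt y)) ↔ blk x < blk y) := by
    rintro ⟨h1, h2⟩
    rcases lt_or_ge (blk x) (blk y) with hlt | hge
    · have := h.far x y (by omega)
      exact iff_of_true this hlt
    · have := h.far' (x := x) (y := y) (by omega)
      unfold Bag.BType.Ordered at h1
      refine iff_of_false ?_ (not_lt.2 hge)
      tauto
  unfold FarLt
  tauto

theorem exists_between (h : IsBlockProduct E τ n blk vt) {x y : V} (hxy : blk x + 4 ≤ blk y)
    (ho : τ.Ordered (vt x) (vt y)) (hr : blk y % 5 ≠ (blk x + 2) % 5)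
    (hr' : blk y % 5 ≠ (blk x + 3) % 5) (hr'' : blk y % 5 ≠ (blk x + 1) % 5 ) :
    Relation.Comp (FarLt E τ blk vt) (FarLt E τ blk vt) x y := by
  have := h.blk_lt y
  -- The residue of `y` is that of `x` plus 0 or 4. Seen from `blk x + 2`, it is then shifted by 3
  -- or 2, so both halves are far pairs. Giving `z` the type of `x` keeps both pairs ordered.
  obtain ⟨z, hz, hzt⟩ := h.surj (blk x + 2) (by omega) _ (h.vt_mem x)
  refine ⟨z, (h.farLt_iff _ _).2 ⟨⟨?_, by omega⟩, by omega⟩,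
    (h.farLt_iff _ _).2 ⟨⟨?_, by omega⟩, by omega⟩⟩
  · rw [hzt]
    exact Iff.rfl
  · rw [hzt]
    exact ho

theorem comp_farLt (h : IsBlockProduct E τ n blk vt) {x y : V}
    (hxy : Relation.Comp (FarLt E τ blk vt) (FarLt E τ blk vt) x y) : blk x < blk y := by
  obtain ⟨z, h1, h2⟩ := hxy
  exact ((h.farLt_iff _ _).1 h1).2.trans ((h.farLt_iff _ _).1 h2).2

/-- `BaseLe` negates a definition of `blk y < blk x`. Shifts by 2 and 3 are decided by `FarLt`,
shifts by 0 and 4 by its square. If the residue of `x` is that of `y` plus 1, then `blk x ≤ blk y`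
would force a gap of at least 4, which the square detects in the other direction. -/
theorem baseLe_of_ordered (h : IsBlockProduct E τ n blk vt) {x y : V}
    (ho : τ.Ordered (vt x) (vt y)) : BaseLe E τ blk vt x y ↔ blk x ≤ blk y := by
  unfold BaseLe
  have c1 : ∀ {x y}, Relation.Comp (FarLt E τ blk vt) (FarLt E τ blk vt) x y → blk x < blk y :=
    h.comp_farLt
  simp only [ho, ho.symm, true_and, not_true, false_and, or_false, h.farLt_iff y x]
  rw [← not_lt, not_iff_not]
  constructor
  · rintro (h1 | h1 | ⟨h1, h2⟩)
    · exact h1.2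
    · exact c1 h1
    · by_contra h3
      exact h2 (h.exists_between (by omega) ho (by omega) (by omega) (by omega))
  · intro hlt
    by_cases hf : blk x % 5 = (blk y + 2) % 5 ∨ blk x % 5 = (blk y + 3) % 5
    · exact Or.inl ⟨⟨ho.symm, hf⟩, hlt⟩
    by_cases h1 : blk x % 5 = (blk y + 1) % 5
    · exact Or.inr (Or.inr ⟨h1, fun h2 => by have := c1 h2; omega⟩)
    · exact Or.inr (Or.inl (h.exists_between (by omega) ho.symm (by omega) (by omega) h1))

theorem baseLe_of_not_ordered {x y : V} (ho : ¬ τ.Ordered (vt x) (vt y)) :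
    BaseLe E τ blk vt x y ↔ blk x % 5 = blk y % 5 ∧ ¬ (E x y ↔ τ.Fwd (vt x) (vt y)) := by
  unfold BaseLe
  tauto

/-- Distinct factors with equal residues are at distance at least 5, so their edges follow `Fwd`; a
deviating edge must be inside one factor. -/
theorem blk_eq_of_baseLe (h : IsBlockProduct E τ n blk vt) {x y : V}
    (ho : ¬ τ.Ordered (vt x) (vt y)) (hxy : BaseLe E τ blk vt x y) : blk x = blk y := by
  obtain ⟨h1, h2⟩ := (baseLe_of_not_ordered ho).1 hxy
  by_contra hne
  apply h2
  rcases lt_or_gt_of_ne hne with hlt | hlt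
  · exact h.far x y (by omega)
  · rw [h.far' (by omega)]
    unfold Bag.BType.Ordered at ho
    tauto

theorem blk_le_of_baseLe (h : IsBlockProduct E τ n blk vt) {x y : V}
    (hxy : BaseLe E τ blk vt x y) : blk x ≤ blk y := by
  by_cases ho : τ.Ordered (vt x) (vt y)
  · exact (h.baseLe_of_ordered ho).1 hxy
  · exact (h.blk_eq_of_baseLe ho hxy).le

/-- For types that are not ordered, the deviating edge lies inside one factor and refutes the
homogeneity that non-adjacency would require. -/
theorem reachable_of_baseLe (h : IsBlockProduct E τ n blk vt) {x y : V}
    (hxy : BaseLe E τ blk vt x y) : τ.typeGraph.Reachable (vt x) (vt y) := by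
  by_cases he : vt x = vt y
  · rw [he]
  refine SimpleGraph.Adj.reachable ⟨he, h.vt_mem x, h.vt_mem y, ?_⟩
  by_cases ho : τ.Ordered (vt x) (vt y)
  · exact Or.inl ho
  right
  have hb := h.blk_eq_of_baseLe ho hxy
  have h2 := ((baseLe_of_not_ordered ho).1 hxy).2
  have hn := h.tournament.not_iff (x := x) (y := y) (fun e => he (by rw [e]))
  have h3 := h.arrow _ (h.blk_lt x) _ (h.vt_mem x) _ (h.vt_mem y)
  have h4 := h.arrow _ (h.blk_lt x) _ (h.vt_mem y) _ (h.vt_mem x)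
  have h3' : (vt x, vt y) ∈ τ.arrow → E x y := fun h' => h3.1 h' x y rfl hb.symm rfl rfl
  have h4' : (vt y, vt x) ∈ τ.arrow → E y x := fun h' => h4.1 h' y x hb.symm rfl rfl rfl
  unfold Bag.BType.Ordered at ho
  tauto

/-- Since all factors have the same type, an adjacency of types is witnessed in every factor. This
lets a path of types be followed without leaving a factor. -/
theorem exists_baseLe_of_adj (h : IsBlockProduct E τ n blk vt) {α β : Bag.VType k}
    (hαβ : τ.typeGraph.Adj α β) {i : ℕ} (hi : i < n) :
    ∃ x y, blk x = i ∧ blk y = i ∧ vt x = α ∧ vt y = β ∧ BaseLe E τ blk vt x y := by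
  obtain ⟨hne, hα, hβ, hd⟩ := hαβ
  by_cases ho : τ.Ordered α β
  · obtain ⟨x, hx, rfl⟩ := h.surj i hi α hα
    obtain ⟨y, hy, rfl⟩ := h.surj i hi β hβ
    exact ⟨x, y, hx, hy, rfl, rfl, (h.baseLe_of_ordered ho).2 (by omega)⟩
  have h3 := h.arrow i hi α hα β hβ
  have h4 := h.arrow i hi β hβ α hα
  have ho' := ho
  unfold Bag.BType.Ordered at ho'
  rcases hd with hd | ⟨h1, h2⟩ | ⟨h1, h2⟩
  · exact absurd hd ho
  · rw [h3] at h2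
    push Not at h2
    obtain ⟨x, y, hx, hy, rfl, rfl, hxy⟩ := h2
    exact ⟨x, y, hx, hy, rfl, rfl, (baseLe_of_not_ordered ho).2 ⟨by omega, by tauto⟩⟩
  · rw [h4] at h2
    push Not at h2
    obtain ⟨y, x, hy, hx, rfl, rfl, hxy⟩ := h2
    rw [h.tournament.not_iff (fun e => hne (by rw [e]))] at hxy
    exact ⟨x, y, hx, hy, rfl, rfl, (baseLe_of_not_ordered ho).2 ⟨by omega, by tauto⟩⟩

end IsBlockProduct

/-! ### Closing the base relation by squaring, and edges between components -/

section Squaring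

variable {V : Type} {R : V → V → Prop}

/-- The square of a relation. -/
def relSq (R : V → V → Prop) : V → V → Prop := Relation.Comp R R

theorem relSq_iterate_refl (hR : ∀ x, R x x) (m : ℕ) (x : V) : relSq^[m] R x x := by
  induction m with
  | zero => exact hR x
  | succ m ih =>
    rw [Function.iterate_succ_apply']
    exact ⟨x, ih, ih⟩

theorem relSq_iterate_mono (hR : ∀ x, R x x) {m m' : ℕ} (h : m ≤ m') {x y : V}
    (hxy : relSq^[m] R x y) : relSq^[m'] R x y := by
  induction h with
  | refl => exact hxy
  | step _ ih =>
    rw [Function.iterate_succ_apply']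
    exact ⟨x, relSq_iterate_refl hR _ x, ih⟩

theorem relSq_iterate_imp {S : V → V → Prop} (hS : ∀ x y z, S x y → S y z → S x z)
    (hRS : ∀ x y, R x y → S x y) (m : ℕ) (x y : V) (hxy : relSq^[m] R x y) : S x y := by
  induction m generalizing x y with
  | zero => exact hRS x y hxy
  | succ m ih =>
    rw [Function.iterate_succ_apply'] at hxy
    obtain ⟨z, h1, h2⟩ := hxy
    exact hS _ _ _ (ih _ _ h1) (ih _ _ h2)

end Squaring

namespace IsBlockProduct

variable {k : ℕ} {V : Type} {E : V → V → Prop} {τ : Bag.BType k} {n : ℕ} {blk : V → ℕ}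
  {vt : V → Bag.VType k}

theorem baseLe_refl (h : IsBlockProduct E τ n blk vt) (x : V) : BaseLe E τ blk vt x x :=
  (h.baseLe_of_ordered Iff.rfl).2 le_rfl

/-- For each edge of the walk, move within the type of `x` to a vertex of the same factor that
witnesses the adjacency, then cross to the next type. These two base steps fit in the first half of
one more squaring; the jump to the factor of `y` is made at the end of the walk. -/
theorem iterate_of_walk (h : IsBlockProduct E τ n blk vt) {α β : Bag.VType k}
    (w : τ.typeGraph.Walk α β) (x y : V) (hx : vt x = α) (hy : vt y = β) (hxy : blk x ≤ blk y) :
    relSq^[w.length + 1] (BaseLe E τ blk vt) x y := by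
  induction w generalizing x with
  | nil =>
    refine relSq_iterate_mono h.baseLe_refl (Nat.zero_le _) ((h.baseLe_of_ordered ?_).2 hxy)
    rw [hx, hy]
    exact Iff.rfl
  | cons hadj w ih =>
    obtain ⟨z, z', hz, hz', hzt, hzt', hzz'⟩ := h.exists_baseLe_of_adj hadj (h.blk_lt x)
    rw [SimpleGraph.Walk.length_cons, Function.iterate_succ_apply']
    refine ⟨z', relSq_iterate_mono h.baseLe_refl (m := 1) (by omega)
      ⟨z, (h.baseLe_of_ordered ?_).2 hz.ge, hzz'⟩, ih z' hzt' hy (by omega)⟩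
    rw [hx, hzt]
    exact Iff.rfl

theorem card_vtype (k : ℕ) : Nat.card (Bag.VType k) = k * 2 ^ k := by
  simp [Nat.card_eq_fintype_card]

/-- The right-hand side is transitive and contains the base relation. Conversely, a path of types
has fewer edges than the `k * 2 ^ k` vertex types. -/
theorem iterate_baseLe_iff (h : IsBlockProduct E τ n blk vt) {m : ℕ} (hm : k * 2 ^ k ≤ m)
    (x y : V) : relSq^[m] (BaseLe E τ blk vt) x y ↔
      τ.typeGraph.Reachable (vt x) (vt y) ∧ blk x ≤ blk y := by
  classical
  constructor
  · refine relSq_iterate_imp (S := fun x y => τ.typeGraph.Reachable (vt x) (vt y) ∧ blk x ≤ blk y)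
      (fun x y z h1 h2 => ⟨h1.1.trans h2.1, h1.2.trans h2.2⟩) (fun x y hxy => ?_) m x y
    exact ⟨h.reachable_of_baseLe hxy, h.blk_le_of_baseLe hxy⟩
  · rintro ⟨⟨w⟩, hxy⟩
    have h1 := w.toPath.2.length_lt
    rw [← Nat.card_eq_fintype_card, card_vtype] at h1
    exact relSq_iterate_mono h.baseLe_refl (by omega) (h.iterate_of_walk w.toPath.1 x y rfl rfl hxy)

/-- Two consecutive factors merge into a bag of type `τ`, so an edge between them behaves like one
inside a single factor. The types stay in their components, so non-adjacency there forces the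
direction of `Fwd`. -/
theorem edge_of_near_of_not_reachable (h : IsBlockProduct E τ n blk vt) {x y : V}
    (hb : blk x + 1 = blk y) (hr : ¬ τ.typeGraph.Reachable (vt x) (vt y)) :
    E x y ↔ τ.Fwd (vt x) (vt y) := by
  have hx := h.vt_mem x
  have hy := h.vt_mem y
  rw [h.near x y hb]
  generalize vt x = α at *
  generalize vt y = β at *
  have hα' := h.mem_left α hx
  have hβ' := h.mem_right β hy
  have n1 := h.near_of_arrow α hx β hy
  have n2 := h.not_near_of_arrow α hx β hy
  have reach : ∀ {γ δ : Bag.VType k}, γ ∈ τ.inhab → δ ∈ τ.inhab → τ.Ordered γ δ →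
      τ.typeGraph.Reachable γ δ := by
    intro γ δ hγ hδ ho
    by_cases he : γ = δ
    · rw [he]
    · exact SimpleGraph.Adj.reachable ⟨he, hγ, hδ, Or.inl ho⟩
  set α' : Bag.VType k := (τ.recol α.1, α.2) with hα'_def
  set β' : Bag.VType k := (β.1, {i | τ.recol i ∈ β.2}) with hβ'_def
  -- Idempotency of the recolouring makes a type and its version in the merged bag an ordered pair.
  have hαα' : τ.typeGraph.Reachable α α' := reach hx hα' (by
    simp [Bag.BType.Ordered, Bag.BType.Fwd, hα'_def, h.recol_idem])
  have hββ' : τ.typeGraph.Reachable β β' := reach hy hβ' (by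
    simp [Bag.BType.Ordered, Bag.BType.Fwd, hβ'_def, h.recol_idem])
  have hr' : ¬ τ.typeGraph.Reachable α' β' := fun hc => hr (hαα'.trans (hc.trans hββ'.symm))
  have f1 : τ.Fwd α' β' ↔ τ.Fwd α β := by
    simp [Bag.BType.Fwd, hα'_def, hβ'_def, h.recol_idem]
  have ho : ¬ τ.Ordered α' β' := fun ho => hr' (reach hα' hβ' ho)
  have hne : α' ≠ β' := fun he => hr' (by rw [he])
  have hadj : ¬ τ.typeGraph.Adj α' β' := fun hc => hr' hc.reachable
  have hadj' : ¬ ((τ.Fwd α' β' ∧ (α', β') ∉ τ.arrow) ∨ (τ.Fwd β' α' ∧ (β', α') ∉ τ.arrow)) :=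
    fun hc => hadj ⟨hne, hα', hβ', Or.inr hc⟩
  unfold Bag.BType.Ordered at ho
  tauto

/-- Between vertex types in distinct components of the graph of types, all edges have the same
direction. -/
theorem edge_of_not_reachable (h : IsBlockProduct E τ n blk vt) {x y : V}
    (hr : ¬ τ.typeGraph.Reachable (vt x) (vt y)) : E x y ↔ τ.Fwd (vt x) (vt y) := by
  have hne : vt x ≠ vt y := fun he => hr (by rw [he])
  have hadj : ¬ τ.typeGraph.Adj (vt x) (vt y) := fun hc => hr hc.reachable
  have hadj' : ¬ (τ.Ordered (vt x) (vt y) ∨ (τ.Fwd (vt x) (vt y) ∧ (vt x, vt y) ∉ τ.arrow) ∨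
      (τ.Fwd (vt y) (vt x) ∧ (vt y, vt x) ∉ τ.arrow)) :=
    fun hc => hadj ⟨hne, h.vt_mem x, h.vt_mem y, hc⟩
  have hn := h.tournament.not_iff (x := x) (y := y) (fun e => hne (by rw [e]))
  unfold Bag.BType.Ordered at hadj'
  rcases lt_trichotomy (blk x) (blk y) with hlt | heq | hlt
  · rcases Nat.lt_or_ge (blk x + 1) (blk y) with hf | hf
    · exact h.far x y hf
    · exact h.edge_of_near_of_not_reachable (by omega) hr
  · have h3 := h.arrow _ (h.blk_lt x) _ (h.vt_mem x) _ (h.vt_mem y)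
    have h4 := h.arrow _ (h.blk_lt x) _ (h.vt_mem y) _ (h.vt_mem x)
    have h3' : (vt x, vt y) ∈ τ.arrow → E x y := fun h' => h3.1 h' x y rfl heq.symm rfl rfl
    have h4' : (vt y, vt x) ∈ τ.arrow → E y x := fun h' => h4.1 h' y x heq.symm rfl rfl rfl
    tauto
  · have key : E y x ↔ τ.Fwd (vt y) (vt x) := by
      rcases Nat.lt_or_ge (blk y + 1) (blk x) with hf | hf
      · exact h.far y x hf
      · exact h.edge_of_near_of_not_reachable (by omega) fun hc => hr hc.symm
    tauto

end IsBlockProduct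

/-! ### Cut-rank and quasi-orderings -/

/-- The matrix factors through one whose rows are indexed by `ι`. -/
theorem cutRank_le_of_factor {V ι : Type} [Finite V] [Fintype ι] (E : V → V → Prop) (X Y : Set V)
    (f : V → ι) (M : ι → V → Prop) (h : ∀ x ∈ X, ∀ y ∈ Y, (E x y ↔ M (f x) y)) :
    cutRank E X Y ≤ Fintype.card ι := by
  classical
  unfold cutRank
  let _ : Fintype Y := Fintype.ofFinite Y
  have e : (Matrix.of fun (x : X) (y : Y) => if E x y then (1 : ZMod 2) else 0) =
      (Matrix.of fun (a : ι) (y : Y) => if M a y then (1 : ZMod 2) else 0).submatrix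
        (fun x : X => f x) id := by
    ext x y
    simp [h x.1 x.2 y.1 y.2]
  have e' : ∀ N : Matrix ι Y (ZMod 2), N.submatrix (fun x : X => f x) id =
      (1 : Matrix ι ι (ZMod 2)).submatrix (fun x : X => f x) id * N := fun N => by
    ext x y
    simp [Matrix.mul_apply, Matrix.one_apply]
  exact (congrArg Matrix.rank (e.trans (e' _))).trans_le
    ((Matrix.rank_mul_le_right _ _).trans (Matrix.rank_le_card_height _))

theorem exists_quasiOrder_of_key {V K : Type} [Finite V] [LinearOrder K] (key : V → K) :
    ∃ (m : ℕ) (c : Fin m → K), StrictMono c ∧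
      IsQuasiOrderWithClasses (fun x y => key x ≤ key y) (fun i => {x | key x = c i}) := by
  classical
  let _ : Fintype V := Fintype.ofFinite V
  let s : Finset K := Finset.univ.image key
  have hs : ∀ v, ∃ i, key v = s.orderEmbOfFin rfl i := fun v => by
    have : key v ∈ Set.range (s.orderEmbOfFin rfl) := by
      rw [Finset.range_orderEmbOfFin]
      simp [s]
    obtain ⟨i, hi⟩ := this
    exact ⟨i, hi.symm⟩
  refine ⟨s.card, s.orderEmbOfFin rfl, (s.orderEmbOfFin rfl).strictMono, ⟨fun i => ?_, fun v => ?_,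
    fun i j x y hx hy => ?_⟩⟩
  · obtain ⟨v, -, hv⟩ := Finset.mem_image.1 (s.orderEmbOfFin_mem rfl i)
    exact ⟨v, hv⟩
  · obtain ⟨i, hi⟩ := hs v
    exact ⟨i, hi, fun j hj => (s.orderEmbOfFin rfl).injective (hj.symm.trans hi)⟩
  · change key x = _ at hx
    change key y = _ at hy
    rw [hx, hy, OrderEmbedding.le_iff_le]

namespace IsBlockProduct

variable {k : ℕ} {V : Type} {E : V → V → Prop} {τ : Bag.BType k} {n : ℕ} {blk : V → ℕ}
  {vt : V → Bag.VType k}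

/-- The cuts of the ordering by components of the vertex types, and then by factors, have small
rank. -/
theorem cutRank_le [Finite V] (h : IsBlockProduct E τ n blk vt)
    (idx : Bag.VType k → ℕ)
    (hidx : ∀ α β, idx α = idx β ↔ τ.typeGraph.Reachable α β) (c : ℕ ×ₗ ℕ) (X Y : Set V)
    (hX : ∀ x ∈ X, toLex (idx (vt x), blk x) ≤ c) (hY : ∀ y ∈ Y, c < toLex (idx (vt y), blk y)) :
    cutRank E X Y ≤ k * 2 := by
  classical
  obtain ⟨a, b, rfl⟩ : ∃ a b, c = toLex (a, b) := ⟨(ofLex c).1, (ofLex c).2, rfl⟩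
  -- The bit marks the class `(a, b)` just before the cut. Within one component, only this class can
  -- be consecutive to a factor beyond the cut, namely number `b + 1`; every other edge is computed
  -- with the recoloured colour.
  refine (cutRank_le_of_factor (ι := Fin k × Bool) E X Y
    (fun x => ((vt x).1, decide (idx (vt x) = a ∧ blk x = b)))
    (fun p y => if p.2 = true ∧ idx (vt y) = a ∧ blk y = b + 1 then p.1 ∈ (vt y).2
      else τ.recol p.1 ∈ (vt y).2) fun x hx y hy => ?_).trans (by simp)
  have hx' := Prod.Lex.toLex_le_toLex.1 (hX x hx)
  have hy' := Prod.Lex.toLex_lt_toLex.1 (hY y hy)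
  simp only [decide_eq_true_eq] at hx' hy' ⊢
  by_cases hr : τ.typeGraph.Reachable (vt x) (vt y)
  · have hi := (hidx _ _).2 hr
    split_ifs with hc
    · exact h.near x y (by omega)
    · exact h.far x y (by omega)
  · have hi := mt (hidx _ _).1 hr
    rw [if_neg (by omega)]
    exact h.edge_of_not_reachable hr

end IsBlockProduct

end TournTrans

namespace TournTrans

open FirstOrder FirstOrder.Language

/-! ### Structures with binary relations and their interpretations -/

/-- The structure whose only relations are the binary ones given by `R`. -/
def binStr (Δ : Sig) {V : Type} (R : ℕ → V → V → Prop) : RelStr Δ :=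
  ⟨V, fun n i t => ∃ h : n = 2, R i (t ⟨0, by omega⟩) (t ⟨1, by omega⟩)⟩

theorem binStr_congr {Δ : Sig} {V : Type} {R R' : ℕ → V → V → Prop}
    (h : ∀ i < Δ 2, ∀ x y, R i x y ↔ R' i x y) : binStr Δ R = binStr Δ R' := by
  unfold binStr
  congr 1
  funext n i t
  apply propext
  refine exists_congr fun hn => ?_
  subst hn
  exact h i i.2 _ _

/-- The atomic formula for the binary symbol of index `i`, which is `⊥` if there is no such
symbol. -/
def binAtom (Γ : Sig) (i : ℕ) {m : ℕ} (s t : Fin 2 ⊕ Fin m) : Γ.lang.BoundedFormula (Fin 2) m :=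
  if h : i < Γ 2 then Relations.boundedFormula₂ (L := Γ.lang) (⟨i, h⟩ : Fin (Γ 2)) (.var s) (.var t)
  else ⊥

/-- The atomic formula for the unary symbol of index `i`, which is `⊥` if there is no such
symbol. -/
def unAtom (Γ : Sig) (i : ℕ) {m : ℕ} (s : Fin 2 ⊕ Fin m) : Γ.lang.BoundedFormula (Fin 2) m :=
  if h : i < Γ 1 then Relations.boundedFormula₁ (L := Γ.lang) (⟨i, h⟩ : Fin (Γ 1)) (.var s)
  else ⊥

theorem realize_binAtom {Γ : Sig} (S : RelStr Γ) (i : ℕ) {m : ℕ} (s t : Fin 2 ⊕ Fin m)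
    (v : Fin 2 → S.V) (xs : Fin m → S.V) : (binAtom Γ i s t).Realize v xs ↔
      ∃ h : i < Γ 2, S.rel 2 ⟨i, h⟩ ![Sum.elim v xs s, Sum.elim v xs t] := by
  unfold binAtom
  split_ifs with h
  · rw [BoundedFormula.realize_rel₂]
    exact ⟨fun h' => ⟨h, h'⟩, fun ⟨_, h'⟩ => h'⟩
  · exact iff_of_false id fun ⟨h', _⟩ => h h'

theorem realize_unAtom {Γ : Sig} (S : RelStr Γ) (i : ℕ) {m : ℕ} (s : Fin 2 ⊕ Fin m)
    (v : Fin 2 → S.V) (xs : Fin m → S.V) : (unAtom Γ i s).Realize v xs ↔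
      ∃ h : i < Γ 1, S.rel 1 ⟨i, h⟩ ![Sum.elim v xs s] := by
  unfold unAtom
  split_ifs with h
  · rw [BoundedFormula.realize_rel₁]
    exact ⟨fun h' => ⟨h, h'⟩, fun ⟨_, h'⟩ => h'⟩
  · exact iff_of_false id fun ⟨h', _⟩ => h h'

theorem realize_binAtom_binStr {Γ : Sig} {V : Type} (R : ℕ → V → V → Prop) {i : ℕ}
    (hi : i < Γ 2) {m : ℕ} (s t : Fin 2 ⊕ Fin m) (v : Fin 2 → (binStr Γ R).V)
    (xs : Fin m → (binStr Γ R).V) :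
    (binAtom Γ i s t).Realize v xs ↔ R i (Sum.elim v xs s) (Sum.elim v xs t) := by
  rw [realize_binAtom]
  exact ⟨fun ⟨_, _, h⟩ => h, fun h => ⟨hi, rfl, h⟩⟩

/-- The interpretation which defines the binary symbol of index `i` by the formula `ψ i`, and has
empty relations for the symbols of other arities. -/
def interpBin {Γ : Sig} (Δ : Sig) (ψ : ℕ → Γ.lang.Formula (Fin 2)) : Transduction Γ Δ :=
  .interp fun n i => if h : n = 2 then (ψ i).relabel (Fin.cast h.symm) else ⊥

theorem outputs_interpBin {Γ Δ : Sig} (ψ : ℕ → Γ.lang.Formula (Fin 2)) (S : RelStr Γ) :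
    (interpBin Δ ψ).outputs S = {binStr Δ fun i (x y : S.V) => (ψ i).Realize ![x, y]} := by
  unfold interpBin Transduction.outputs binStr
  congr 2
  funext n i t
  apply propext
  beta_reduce
  split_ifs with h
  · subst h
    rw [Formula.realize_relabel]
    have e : t ∘ Fin.cast rfl = ![t 0, t 1] := by
      funext j
      fin_cases j <;> rfl
    rw [e]
    exact ⟨fun h => ⟨rfl, h⟩, fun ⟨_, h⟩ => h⟩
  · exact iff_of_false id fun ⟨h', _⟩ => h h'

/-! ### Transductions which do not change the universe and the edges -/

/-- The relation for the binary symbol of index `0`. -/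
def RelStr.edge {Γ : Sig} (S : RelStr Γ) (x y : S.V) : Prop :=
  ∃ h : 0 < Γ 2, S.rel 2 ⟨0, h⟩ ![x, y]

/-- The transduction changes neither the universe nor the binary relation of index `0`. -/
def Transduction.KeepsEdges {Γ Δ : Sig} (Φ : Transduction Γ Δ) : Prop :=
  ∀ (S : RelStr Γ) (T : RelStr Δ), T ∈ Φ.outputs S →
    ∃ r, T = ⟨S.V, r⟩ ∧ ∀ x y, RelStr.edge (Γ := Δ) ⟨S.V, r⟩ x y ↔ S.edge x y

theorem Transduction.KeepsEdges.comp {Γ Δ Θ : Sig} {Φ : Transduction Γ Δ} {Ψ : Transduction Δ Θ}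
    (hΦ : Φ.KeepsEdges) (hΨ : Ψ.KeepsEdges) : (Transduction.comp Φ Ψ).KeepsEdges := by
  intro S T hT
  obtain ⟨U, hU, hT⟩ := Set.mem_iUnion₂.1 hT
  obtain ⟨r, rfl, hr⟩ := hΦ S U hU
  obtain ⟨r', rfl, hr'⟩ := hΨ _ T hT
  exact ⟨r', rfl, fun x y => (hr' x y).trans (hr x y)⟩

theorem keepsEdges_colour {Γ : Sig} (hΓ : 0 < Γ 2) (c : ℕ) :
    (Transduction.colour (Γ := Γ) c).KeepsEdges := by
  rintro S T ⟨r, rfl, hr⟩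
  refine ⟨r, rfl, fun x y => ⟨fun ⟨_, h⟩ => ⟨hΓ, (hr 2 ⟨0, hΓ⟩ _).1 h⟩, fun ⟨_, h⟩ => ?_⟩⟩
  exact ⟨hΓ.trans_le (le_self_add (a := Γ) (b := Finsupp.single 1 c) 2), (hr 2 ⟨0, hΓ⟩ _).2 h⟩

theorem keepsEdges_interpBin {Γ Δ : Sig} (hΔ : 0 < Δ 2) {ψ : ℕ → Γ.lang.Formula (Fin 2)}
    (h0 : ψ 0 = binAtom Γ 0 (.inl 0) (.inl 1)) : (interpBin Δ ψ).KeepsEdges := by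
  intro S T hT
  rw [outputs_interpBin] at hT
  obtain rfl := hT
  refine ⟨_, rfl, fun x y => ?_⟩
  have key := realize_binAtom S 0 (m := 0) (.inl 0) (.inl 1) ![x, y] default
  refine Iff.trans ?_ key
  rw [← h0]
  exact ⟨fun ⟨_, _, h⟩ => h, fun h => ⟨hΔ, rfl, h⟩⟩

theorem Transduction.KeepsEdges.isExtension {Φ : Transduction sigE sigELe} (hΦ : Φ.KeepsEdges) :
    Φ.IsExtension le_self_add := by
  intro S T hT
  obtain ⟨r, rfl, hr⟩ := hΦ S T hT
  refine ⟨r, rfl, fun n R t => ?_⟩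
  by_cases hn : n = 2
  · subst hn
    have h1 : sigE 2 = 1 := by simp
    obtain rfl : R = ⟨0, by omega⟩ := Fin.ext (by omega)
    have ht : ![t 0, t 1] = t := by
      funext j
      fin_cases j <;> rfl
    have := hr (t 0) (t 1)
    unfold RelStr.edge at this
    rw [ht] at this
    exact ⟨fun h => (this.1 ⟨by simp, h⟩).2, fun h => (this.2 ⟨by simp, h⟩).2⟩
  · have h0 : sigE n = 0 := Finsupp.single_eq_of_ne hn
    exact absurd R.2 (by omega)

/-! ### Iterated transductions -/

/-- Performing a transduction `n + 1` times. -/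
def Transduction.repeated {Γ : Sig} (Φ : Transduction Γ Γ) : ℕ → Transduction Γ Γ
  | 0 => Φ
  | n + 1 => .comp (Φ.repeated n) Φ

theorem Transduction.mem_comp {Γ Δ Θ : Sig} {Φ : Transduction Γ Δ} {Ψ : Transduction Δ Θ}
    {S : RelStr Γ} {T : RelStr Δ} {U : RelStr Θ} (hT : T ∈ Φ.outputs S) (hU : U ∈ Ψ.outputs T) :
    U ∈ (Transduction.comp Φ Ψ).outputs S := Set.mem_iUnion₂.2 ⟨T, hT, hU⟩

theorem Transduction.KeepsEdges.repeated {Γ : Sig} {Φ : Transduction Γ Γ} (hΦ : Φ.KeepsEdges)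
    (n : ℕ) : (Φ.repeated n).KeepsEdges := by
  induction n with
  | zero => exact hΦ
  | succ n ih => exact ih.comp hΦ

theorem Transduction.mem_repeated {Γ : Sig} {Φ : Transduction Γ Γ} (S : ℕ → RelStr Γ)
    (h : ∀ j, S (j + 1) ∈ Φ.outputs (S j)) (n : ℕ) : S (n + 1) ∈ (Φ.repeated n).outputs (S 0) := by
  induction n with
  | zero => exact h 0
  | succ n ih => exact mem_comp ih (h _)

/-- As `Φ` returns to its own signature, its code is a constant in the recursion. -/
theorem Transduction.primrec_code_repeated {Γ : Sig} (Φ : Transduction Γ Γ) :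
    Primrec fun n => (Φ.repeated n).code := by
  have h : (fun n => (Φ.repeated n).code) =
      fun n => Nat.rec Φ.code (fun _ c => Nat.pair 5 (Nat.pair c Φ.code)) n := by
    funext n
    induction n with
    | zero => rfl
    | succ n ih =>
      change Nat.pair 5 (Nat.pair (Φ.repeated n).code Φ.code) = _
      rw [ih]
  rw [h]
  refine Primrec.nat_rec₁ Φ.code ?_
  exact Primrec₂.natPair.comp (.const 5) (Primrec₂.natPair.comp .snd (.const _))

theorem Transduction.primrec_code_comp {Γ Δ Θ : Sig} {Φ : ℕ → Transduction Γ Δ}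
    {Ψ : ℕ → Transduction Δ Θ} (hΦ : Primrec fun k => (Φ k).code)
    (hΨ : Primrec fun k => (Ψ k).code) :
    Primrec fun k => (Transduction.comp (Φ k) (Ψ k)).code :=
  Primrec₂.natPair.comp (.const 5) (Primrec₂.natPair.comp hΦ hΨ)

/-! ### The transduction producing the quasi-ordering -/

/-- The signature with eight binary symbols. -/
noncomputable abbrev sigOct : Sig := Finsupp.single 2 8

theorem sigOct_two : sigOct 2 = 8 := by simp

/-- Initialisation: all relations except for the edges are empty. -/
noncomputable def initOct : Transduction sigE sigOct :=
  interpBin sigOct fun i => if i = 0 then binAtom sigE 0 (.inl 0) (.inl 1) else ⊥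

/-- Adding the product of two arbitrary sets to each of the relations except for the edges. -/
noncomputable def addRectangles : Transduction sigOct sigOct :=
  .comp (.colour 16) (interpBin sigOct fun i =>
    if i = 0 then binAtom _ 0 (.inl 0) (.inl 1)
    else binAtom _ i (.inl 0) (.inl 1) ⊔ (unAtom _ i (.inl 0) ⊓ unAtom _ (8 + i) (.inl 1)))

/-- Changing the relation of index `j`. -/
noncomputable def updateRel (j : ℕ) (φ : sigOct.lang.Formula (Fin 2)) : Transduction sigOct sigOct :=
  interpBin sigOct fun i => if i = j then φ else binAtom _ i (.inl 0) (.inl 1)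

/-- The formula defining the square of the relation of index `1`. -/
noncomputable def squareFormula : sigOct.lang.Formula (Fin 2) :=
  BoundedFormula.ex (n := 0) (binAtom sigOct 1 (.inl 0) (.inr 0) ⊓ binAtom sigOct 1 (.inr 0) (.inl 1))

/-- The formula which selects the edges or the non-edges, according to the relations of indices
`1` and `2`. -/
noncomputable def selectFormula : sigOct.lang.Formula (Fin 2) :=
  (binAtom sigOct 1 (.inl 0) (.inl 1) ⊓ binAtom sigOct 0 (.inl 0) (.inl 1)) ⊔
    (binAtom sigOct 2 (.inl 0) (.inl 1) ⊓ ∼(binAtom sigOct 0 (.inl 0) (.inl 1)))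

/-- The formula which defines the base relation from the selected one and its square. -/
noncomputable def baseFormula : sigOct.lang.Formula (Fin 2) :=
  (binAtom sigOct 4 (.inl 0) (.inl 1) ⊓ ∼(binAtom sigOct 1 (.inl 1) (.inl 0) ⊔
    (binAtom sigOct 2 (.inl 1) (.inl 0) ⊔
      (binAtom sigOct 3 (.inl 1) (.inl 0) ⊓ ∼(binAtom sigOct 2 (.inl 0) (.inl 1)))))) ⊔
  ((binAtom sigOct 5 (.inl 0) (.inl 1) ⊓ ∼(binAtom sigOct 0 (.inl 0) (.inl 1))) ⊔
    (binAtom sigOct 6 (.inl 0) (.inl 1) ⊓ binAtom sigOct 0 (.inl 0) (.inl 1)))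

/-- The output: the edges, and the union of the relations of indices `1` and `7`. -/
noncomputable def outputLe : Transduction sigOct sigELe :=
  interpBin sigELe fun i => if i = 0 then binAtom _ 0 (.inl 0) (.inl 1)
    else binAtom _ 1 (.inl 0) (.inl 1) ⊔ binAtom _ 7 (.inl 0) (.inl 1)

/-- The transduction producing the quasi-ordering, with `N + 1` rounds of guessing and of
squaring. -/
noncomputable def orderTransduction (N : ℕ) : Transduction sigE sigELe :=
  .comp initOct (.comp (addRectangles.repeated N) (.comp (updateRel 1 selectFormula)
    (.comp (updateRel 2 squareFormula) (.comp (updateRel 1 baseFormula)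
      (.comp ((updateRel 1 squareFormula).repeated N) outputLe)))))

/-- This must hold for all guesses, including wrong ones: no stage touches the universe or the
relation of index `0`. -/
theorem isExtension_orderTransduction (N : ℕ) :
    (orderTransduction N).IsExtension le_self_add := by
  have h8 : 0 < sigOct 2 := by simp
  have hu : ∀ j φ, j ≠ 0 → (updateRel j φ).KeepsEdges := fun j φ hj =>
    keepsEdges_interpBin h8 (if_neg hj.symm)
  exact Transduction.KeepsEdges.isExtension <|
    (keepsEdges_interpBin h8 rfl).comp <|
    ((keepsEdges_colour h8 16).comp (keepsEdges_interpBin h8 rfl)).repeated N |>.comp <|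
    (hu 1 _ one_ne_zero).comp <| (hu 2 _ two_ne_zero).comp <| (hu 1 _ one_ne_zero).comp <|
    ((hu 1 _ one_ne_zero).repeated N).comp <| keepsEdges_interpBin (by simp) rfl

theorem primrec_code_orderTransduction {f : ℕ → ℕ} (hf : Primrec f) :
    Primrec fun k => (orderTransduction (f k)).code := by
  have hr : ∀ Φ : Transduction sigOct sigOct, Primrec fun k => (Φ.repeated (f k)).code :=
    fun Φ => Φ.primrec_code_repeated.comp hf
  exact Transduction.primrec_code_comp (.const _) <|
    Transduction.primrec_code_comp (hr _) <| Transduction.primrec_code_comp (.const _) <|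
    Transduction.primrec_code_comp (.const _) <| Transduction.primrec_code_comp (.const _) <|
    Transduction.primrec_code_comp (hr _) (.const _)

theorem initOct_mem {V : Type} (E : V → V → Prop) :
    binStr sigOct (fun i x y => i = 0 ∧ E x y) ∈ initOct.outputs (graphStr E) := by
  rw [initOct, outputs_interpBin]
  refine binStr_congr fun i _ x y => ?_
  split_ifs with h
  · refine Iff.trans ?_ (realize_binAtom_binStr (fun _ => E) (by simp) (m := 0) _ _ _ _).symm
    exact ⟨fun h' => h'.2, fun h' => ⟨h, h'⟩⟩
  · exact iff_of_false (fun h' => h h'.1) id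

/-- The structure whose only relations are the binary ones given by `R`, and sixteen unary ones
given by `P` and `Q`. -/
noncomputable def colouredStr {V : Type} (R : ℕ → V → V → Prop) (P Q : ℕ → V → Prop) :
    RelStr (sigOct + Finsupp.single 1 16) :=
  ⟨V, fun n i t => (∃ h : n = 2, R i (t ⟨0, by omega⟩) (t ⟨1, by omega⟩)) ∨
    (∃ h : n = 1, if (i : ℕ) < 8 then P i (t ⟨0, by omega⟩) else Q ((i : ℕ) - 8) (t ⟨0, by omega⟩))⟩

/-- Colours `0` to `7` hold the left sides and `8` to `15` the right sides. The interpretation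
discards them afterwards, so the next round starts from the same signature. -/
theorem addRectangles_mem {V : Type} (R : ℕ → V → V → Prop) (P Q : ℕ → V → Prop) :
    binStr sigOct (fun i x y => if i = 0 then R 0 x y else R i x y ∨ (P i x ∧ Q i y)) ∈
      addRectangles.outputs (binStr sigOct R) := by
  have h2 : (sigOct + Finsupp.single 1 16 : Sig) 2 = 8 := by simp
  have h1 : (sigOct + Finsupp.single 1 16 : Sig) 1 = 16 := by simp
  have hT : colouredStr R P Q ∈ (Transduction.colour 16).outputs (binStr sigOct R) := by
    refine ⟨(colouredStr R P Q).rel, rfl, fun n i t => ⟨?_, fun h => Or.inl h⟩⟩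
    rintro (h | ⟨rfl, h⟩)
    · exact h
    · exact absurd i.2 (by simp)
  refine Transduction.mem_comp hT ?_
  rw [outputs_interpBin]
  refine binStr_congr fun i hi x y => ?_
  rw [sigOct_two] at hi
  have hb : ∀ i < 8, (binAtom (sigOct + Finsupp.single 1 16) i (m := 0) (.inl 0) (.inl 1)).Realize
      (M := (colouredStr R P Q).V) ![x, y] default ↔ R i x y := fun i hi => by
    rw [realize_binAtom]
    constructor
    · rintro ⟨_, ⟨_, h⟩ | ⟨h, _⟩⟩
      · exact h
      · omega
    · exact fun h => ⟨by omega, Or.inl ⟨rfl, h⟩⟩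
  have hP : (unAtom (sigOct + Finsupp.single 1 16) i (m := 0) (.inl 0)).Realize
      (M := (colouredStr R P Q).V) ![x, y] default ↔ P i x := by
    rw [realize_unAtom]
    constructor
    · rintro ⟨_, ⟨h, _⟩ | ⟨_, h⟩⟩
      · omega
      · rw [if_pos hi] at h
        exact h
    · intro h
      refine ⟨by omega, Or.inr ⟨rfl, ?_⟩⟩
      rw [if_pos hi]
      exact h
  have hQ : (unAtom (sigOct + Finsupp.single 1 16) (8 + i) (m := 0) (.inl 1)).Realize
      (M := (colouredStr R P Q).V) ![x, y] default ↔ Q i y := by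
    rw [realize_unAtom]
    constructor
    · rintro ⟨_, ⟨h, _⟩ | ⟨_, h⟩⟩
      · omega
      · rw [if_neg (by simp), Nat.add_sub_cancel_left] at h
        exact h
    · intro h
      refine ⟨by omega, Or.inr ⟨rfl, ?_⟩⟩
      rw [if_neg (by simp), Nat.add_sub_cancel_left]
      exact h
  split_ifs with h
  · exact (hb 0 (by omega)).symm
  · refine Iff.trans ?_ Formula.realize_sup.symm
    exact or_congr (hb i hi).symm
      ((and_congr hP hQ).symm.trans Formula.realize_inf.symm)

theorem updateRel_mem {V : Type} (R : ℕ → V → V → Prop) (j : ℕ)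
    (φ : sigOct.lang.Formula (Fin 2)) (Q : V → V → Prop)
    (h : ∀ x y : (binStr sigOct R).V, φ.Realize ![x, y] ↔ Q x y) :
    binStr sigOct (Function.update R j Q) ∈ (updateRel j φ).outputs (binStr sigOct R) := by
  rw [updateRel, outputs_interpBin]
  refine binStr_congr fun i hi x y => ?_
  split_ifs with hij
  · subst hij
    rw [Function.update_self]
    exact (h x y).symm
  · rw [Function.update_of_ne hij]
    exact (realize_binAtom_binStr R hi (m := 0) (.inl 0) (.inl 1) ![x, y] default).symm

theorem realize_squareFormula {V : Type} (R : ℕ → V → V → Prop) (x y : (binStr sigOct R).V) :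
    squareFormula.Realize ![x, y] ↔ relSq (R 1) x y := by
  unfold squareFormula Formula.Realize
  rw [BoundedFormula.realize_ex]
  refine exists_congr fun z => ?_
  rw [BoundedFormula.realize_inf, realize_binAtom_binStr R (by simp),
    realize_binAtom_binStr R (by simp)]
  rfl

theorem realize_selectFormula {V : Type} (R : ℕ → V → V → Prop) (x y : (binStr sigOct R).V) :
    selectFormula.Realize ![x, y] ↔ (R 1 x y ∧ R 0 x y) ∨ (R 2 x y ∧ ¬ R 0 x y) := by
  unfold selectFormula Formula.Realize
  simp only [BoundedFormula.realize_sup, BoundedFormula.realize_inf, BoundedFormula.realize_not,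
    realize_binAtom_binStr R (show 0 < sigOct 2 by simp),
    realize_binAtom_binStr R (show 1 < sigOct 2 by simp),
    realize_binAtom_binStr R (show 2 < sigOct 2 by simp)]
  rfl

theorem realize_baseFormula {V : Type} (R : ℕ → V → V → Prop) (x y : (binStr sigOct R).V) :
    baseFormula.Realize ![x, y] ↔
      (R 4 x y ∧ ¬ (R 1 y x ∨ R 2 y x ∨ (R 3 y x ∧ ¬ R 2 x y))) ∨ (R 5 x y ∧ ¬ R 0 x y) ∨
        (R 6 x y ∧ R 0 x y) := by
  unfold baseFormula Formula.Realize
  simp only [BoundedFormula.realize_sup, BoundedFormula.realize_inf, BoundedFormula.realize_not,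
    realize_binAtom_binStr R (show 0 < sigOct 2 by simp),
    realize_binAtom_binStr R (show 1 < sigOct 2 by simp),
    realize_binAtom_binStr R (show 2 < sigOct 2 by simp),
    realize_binAtom_binStr R (show 3 < sigOct 2 by simp),
    realize_binAtom_binStr R (show 4 < sigOct 2 by simp),
    realize_binAtom_binStr R (show 5 < sigOct 2 by simp),
    realize_binAtom_binStr R (show 6 < sigOct 2 by simp)]
  rfl

theorem outputLe_mem {V : Type} (R : ℕ → V → V → Prop) :
    graphLeStr (R 0) (fun x y => R 1 x y ∨ R 7 x y) ∈ outputLe.outputs (binStr sigOct R) := by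
  rw [outputLe, outputs_interpBin]
  change binStr sigELe (fun i x y => if i = 0 then R 0 x y else R 1 x y ∨ R 7 x y) = _
  refine binStr_congr fun i hi x y => ?_
  split_ifs with h
  · exact (realize_binAtom_binStr (Γ := sigOct) R (i := 0) (by simp) (m := 0) (.inl 0) (.inl 1) ![x, y] default).symm
  · refine Iff.trans ?_ Formula.realize_sup.symm
    exact or_congr (realize_binAtom_binStr (Γ := sigOct) R (i := 1) (by simp) (m := 0) (.inl 0) (.inl 1) ![x, y] default).symm
      (realize_binAtom_binStr (Γ := sigOct) R (i := 7) (by simp) (m := 0) (.inl 0) (.inl 1) ![x, y] default).symm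

theorem graphLeStr_mem_orderTransduction {V : Type} (E : V → V → Prop) (N : ℕ) (cls : V → ℕ)
    (hcls : ∀ x, cls x < N + 1) (F : ℕ → V → V → Prop)
    (hF : ∀ i x x' y, cls x = cls x' → F i x y → F i x' y) (D base : V → V → Prop)
    (hD : ∀ x y, D x y ↔ (F 1 x y ∧ E x y) ∨ (F 2 x y ∧ ¬ E x y))
    (hbase : ∀ x y, base x y ↔
      (F 4 x y ∧ ¬ (D y x ∨ Relation.Comp D D y x ∨ (F 3 y x ∧ ¬ Relation.Comp D D x y))) ∨
        (F 5 x y ∧ ¬ E x y) ∨ (F 6 x y ∧ E x y)) :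
    graphLeStr E (fun x y => relSq^[N + 1] base x y ∨ F 7 x y) ∈
      (orderTransduction N).outputs (graphStr E) := by
  -- State after `j` rounds: rows of a class coincide by `hF`, so each class contributes one
  -- rectangle to each relation.
  let G : ℕ → ℕ → V → V → Prop := fun j i x y => if i = 0 then E x y else F i x y ∧ cls x < j
  have hG : ∀ j, binStr sigOct (G (j + 1)) ∈ addRectangles.outputs (binStr sigOct (G j)) := by
    intro j
    have := addRectangles_mem (G j) (fun _ x => cls x = j) fun i y => ∃ x, cls x = j ∧ F i x y
    convert this using 1
    refine binStr_congr fun i _ x y => ?_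
    by_cases hi : i = 0
    · simp [G, hi]
    simp only [G, hi, if_false]
    constructor
    · rintro ⟨h, h'⟩
      rcases Nat.lt_succ_iff_lt_or_eq.1 h' with h' | h'
      · exact Or.inl ⟨h, h'⟩
      · exact Or.inr ⟨h', x, h', h⟩
    · rintro (⟨h, h'⟩ | ⟨h, x', hx', h'⟩)
      · exact ⟨h, by omega⟩
      · exact ⟨hF i x' x y (by omega) h', by omega⟩
  let H : ℕ → V → V → Prop := fun i => if i = 0 then E else F i
  have hH : binStr sigOct (G (N + 1)) = binStr sigOct H := binStr_congr fun i _ x y => by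
    by_cases hi : i = 0 <;> simp [G, H, hi, hcls x]
  have h0 : binStr sigOct (G 0) ∈ initOct.outputs (graphStr E) := by
    convert initOct_mem E using 1
    exact binStr_congr fun i _ x y => by by_cases hi : i = 0 <;> simp [G, hi]
  have h1 := Transduction.mem_repeated (fun j => binStr sigOct (G j)) hG N
  simp only [hH] at h1
  -- Slots are reused: index `1` holds in turn the guess, `D`, `base` and the iterated squares of
  -- `base`; index `2` passes from a guess to the square of `D`. Index `7` survives until the
  -- output.
  let H1 := Function.update H 1 D
  let H2 := Function.update H1 2 (Relation.Comp D D)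
  let H3 : ℕ → ℕ → V → V → Prop := fun j => Function.update H2 1 (relSq^[j] base)
  have h2 : binStr sigOct H1 ∈ (updateRel 1 selectFormula).outputs (binStr sigOct H) :=
    updateRel_mem H 1 _ _ fun x y => (realize_selectFormula H x y).trans (hD x y).symm
  have h3 : binStr sigOct H2 ∈ (updateRel 2 squareFormula).outputs (binStr sigOct H1) :=
    updateRel_mem H1 2 _ _ fun x y => realize_squareFormula H1 x y
  have h4 : binStr sigOct (H3 0) ∈ (updateRel 1 baseFormula).outputs (binStr sigOct H2) :=
    updateRel_mem H2 1 _ _ fun x y => (realize_baseFormula H2 x y).trans (hbase x y).symm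
  have h5 : ∀ j, binStr sigOct (H3 (j + 1)) ∈
      (updateRel 1 squareFormula).outputs (binStr sigOct (H3 j)) := by
    intro j
    have e : H3 (j + 1) = Function.update (H3 j) 1 (relSq (relSq^[j] base)) := by
      simp only [H3, Function.update_idem, Function.iterate_succ_apply']
    rw [e]
    exact updateRel_mem (H3 j) 1 _ _ fun x y => realize_squareFormula (H3 j) x y
  have h6 := Transduction.mem_repeated (fun j => binStr sigOct (H3 j)) h5 N
  exact Transduction.mem_comp h0 <| Transduction.mem_comp h1 <| Transduction.mem_comp h2 <|
    Transduction.mem_comp h3 <| Transduction.mem_comp h4 <| Transduction.mem_comp h6 <|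
    outputLe_mem (H3 (N + 1))

end TournTrans

/-! ### The guessed relations and the conclusion -/

namespace TournTrans

/-- The relations guessed for a product of bags: those which define the base relation, and the
ordering `idx` of the components of the vertex types. -/
def guessed {k : ℕ} {V : Type} (τ : Bag.BType k) (blk : V → ℕ) (vt : V → Bag.VType k)
    (idx : Bag.VType k → ℕ) (i : ℕ) (x y : V) : Prop :=
  match i with
  | 1 => FarPair τ blk vt x y ∧ τ.Fwd (vt x) (vt y)
  | 2 => FarPair τ blk vt x y ∧ ¬ τ.Fwd (vt x) (vt y)
  | 3 => τ.Ordered (vt x) (vt y) ∧ blk y % 5 = (blk x + 1) % 5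
  | 4 => τ.Ordered (vt x) (vt y)
  | 5 => ¬ τ.Ordered (vt x) (vt y) ∧ blk x % 5 = blk y % 5 ∧ τ.Fwd (vt x) (vt y)
  | 6 => ¬ τ.Ordered (vt x) (vt y) ∧ blk x % 5 = blk y % 5 ∧ ¬ τ.Fwd (vt x) (vt y)
  | 7 => idx (vt x) < idx (vt y)
  | _ => False

theorem guessed_congr {k : ℕ} {V : Type} {τ : Bag.BType k} {blk : V → ℕ} {vt : V → Bag.VType k}
    {idx : Bag.VType k → ℕ} (i : ℕ) {x x' : V} (y : V) (ht : vt x = vt x')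
    (hb : blk x % 5 = blk x' % 5) (h : guessed τ blk vt idx i x y) :
    guessed τ blk vt idx i x' y := by
  have h1 : (blk x + 1) % 5 = (blk x' + 1) % 5 := by omega
  have h2 : (blk x + 2) % 5 = (blk x' + 2) % 5 := by omega
  have h3 : (blk x + 3) % 5 = (blk x' + 3) % 5 := by omega
  unfold guessed FarPair at *
  rw [ht, h1, h2, h3, hb] at h
  exact h

theorem exists_component_index {k : ℕ} (τ : Bag.BType k) :
    ∃ idx : Bag.VType k → ℕ, ∀ α β, idx α = idx β ↔ τ.typeGraph.Reachable α β := by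
  let e := Finite.equivFin τ.typeGraph.ConnectedComponent
  refine ⟨fun α => e (τ.typeGraph.connectedComponentMk α), fun α β => ?_⟩
  rw [← SimpleGraph.ConnectedComponent.eq, Fin.val_inj, e.apply_eq_iff_eq]

theorem IsBlockProduct.graphLeStr_mem {k : ℕ} {V : Type} {E : V → V → Prop} {τ : Bag.BType k}
    {n : ℕ} {blk : V → ℕ} {vt : V → Bag.VType k} (h : IsBlockProduct E τ n blk vt)
    (idx : Bag.VType k → ℕ) (hidx : ∀ α β, idx α = idx β ↔ τ.typeGraph.Reachable α β) :
    graphLeStr E (fun x y => toLex (idx (vt x), blk x) ≤ toLex (idx (vt y), blk y)) ∈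
      (orderTransduction (5 * (k * 2 ^ k))).outputs (graphStr E) := by
  let e := Finite.equivFin (Fin 5 × Bag.VType k)
  have hc : Nat.card (Fin 5 × Bag.VType k) = 5 * (k * 2 ^ k) := by
    rw [Nat.card_prod, IsBlockProduct.card_vtype, Nat.card_fin]
  -- The guessed relations see a vertex only through its residue modulo 5 and its type, hence `5 *
  -- (k * 2 ^ k)` classes. The same number also suffices for the squarings.
  let cls : V → ℕ := fun x => e (⟨blk x % 5, Nat.mod_lt _ (by norm_num)⟩, vt x)
  have key := graphLeStr_mem_orderTransduction E (5 * (k * 2 ^ k)) cls (fun x => by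
      rw [← hc]
      exact (Fin.is_lt _).trans (Nat.lt_succ_self _)) (guessed τ blk vt idx)
    (fun i x x' y hxx' => by
      have h1 := e.injective (Fin.val_injective hxx')
      exact guessed_congr i y (congrArg Prod.snd h1) (congrArg (fun p => (Prod.fst p).val) h1))
    (FarLt E τ blk vt) (BaseLe E τ blk vt) (fun x y => Iff.rfl) (fun x y => Iff.rfl)
  convert key using 2
  funext x y
  rw [h.iterate_baseLe_iff (by omega), ← hidx, Prod.Lex.toLex_le_toLex]
  exact propext or_comm

end TournTrans

theorem mainTheorem4 :
    ∃ Ψ : ℕ → Transduction sigE sigELe,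
      Computable (fun k => (Ψ k).code) ∧
      ∀ k : ℕ, (Ψ k).IsExtension le_self_add ∧
        ∀ (p q : ℕ) (V : Type) [Finite V] (E : V → V → Prop) (B : Bag k),
          B.InC → B.HasIdemFactorisation p q → B.IsInternal E →
          ∃ (m : ℕ) (X : Fin m → Set V) (le : V → V → Prop),
            IsQuasiOrderWithClasses le X ∧
            (∀ i, ∃ C : Bag k, C.InC ∧ C.HasDepth (p - 1) (q + 2 * p) ∧
              C.IsInternal (fun x y : X i => E x y)) ∧
            (∀ i, cutRank E (⋃ j, ⋃ (_ : j ≤ i), X j) (⋃ j, ⋃ (_ : i < j), X j)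
              ≤ k * (2 ^ k + 1)) ∧
            graphLeStr E le ∈ (Ψ k).outputs (graphStr E) := by
  refine ⟨fun k => orderTransduction (5 * (k * 2 ^ k)), ?_, fun k =>
    ⟨isExtension_orderTransduction _, fun p q V _ E B _ hB hE => ?_⟩⟩
  · have hpow : Primrec fun k : ℕ => 2 ^ k :=
      (Primrec₂.unpaired'.1 Nat.Primrec.pow).comp (.const 2) .id
    exact (primrec_code_orderTransduction (Primrec.nat_mul.comp (.const 5)
      (Primrec.nat_mul.comp .id hpow))).to_comp
  obtain ⟨τ, n, blk, vt, h, hC⟩ := hB.exists_isBlockProduct hE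
  obtain ⟨idx, hidx⟩ := exists_component_index τ
  obtain ⟨m, c, hc, hX⟩ := exists_quasiOrder_of_key fun x => toLex (idx (vt x), blk x)
  refine ⟨m, _, _, hX, fun i => ?_, fun i => ?_, h.graphLeStr_mem idx hidx⟩
  · obtain ⟨x, hx⟩ := hX.nonempty i
    -- A class is the set of vertices of one factor whose types lie in one component.
    obtain ⟨C, hCd, hCi⟩ := hC (blk x) (h.blk_lt x) {α | idx α = idx (vt x)}
      {y | toLex (idx (vt y), blk y) = c i} fun y => by
        change _ = _ ↔ _ ∧ _ = _
        rw [← (show _ = c i from hx), toLex_inj, Prod.mk.injEq, and_comm]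
    exact ⟨C, hCd.inC, hCd.mono_right (by omega), hCi⟩
  -- The cuts have rank at most `k * 2`, and `2 ≤ 2 ^ k + 1`.
  · refine (h.cutRank_le idx hidx (c i) _ _ (fun x hx => ?_) (fun y hy => ?_)).trans
      (Nat.mul_le_mul_left k (Nat.succ_le_succ Nat.one_le_two_pow))
    · obtain ⟨j, hj, hx⟩ := Set.mem_iUnion₂.1 hx
      exact (show _ = c j from hx).trans_le (hc.monotone hj)
    · obtain ⟨j, hj, hy⟩ := Set.mem_iUnion₂.1 hy
      exact (hc hj).trans_eq (show _ = c j from hy).symm
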